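/- Let $D\subset\mathbb R^2=\mathbb C$ be a compact, connected and simply connected domain with non-empty interior whose boundary $\gamma=\partial D$ is a smooth (regular, simple) closed curve. Let $F=(f,g):D\to D$ be a symplectomorphism, i.e. a diffeomorphism of $D$, smooth up to the boundary together with its inverse, with $F^*(dx\wedge dy)=dx\wedge dy$ (that is, $f_xg_y-f_yg_x=1$). Suppose that * $F$ is the identity on $\gamma$; * $F$ is moderate: identifying $\mathbb C^2$ with the cotangent bundle $T^*\Delta$ of the diagonal by $(z_1,z_2)\mapsto\bigl(\tfrac{z_1+z_2}{2},\,i(z_1-z_2)\bigr)$ (base point, covector), the graph $\{(z,F(z)):z\in D\}$ is transverse at each of its points to the cotangent fibre through that point (equivalently, $2+f_x+g_y\neq0$ everywhere on $D$); * $F$ has no conformal points on $\gamma$, where a conformal point is a point at which the derivative $dF$ is a similarity. Then $F$ has at least two conformal points in the interior of $D$, counted with multiplicity. That is: either $F$ has infinitely many conformal points in the interior of $D$, or it has finitely many and the sum of their multiplicities is at least $2$. Here the multiplicity of an isolated conformal point $p$ is the index at $p$ of the vector field $V=(f_x-g_y)\,\partial_x+(f_y+g_x)\,\partial_y$, whose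 zeros are exactly the conformal points: the rotation number of $V$ along small counterclockwise circles around $p$. -/

import Mathlib

open Set Filter Topology
open scoped ContDiff

namespace ConformalPoints

/-- `γ` is a `1`-periodic parametrisation of a smooth (regular, simple) closed curve. -/
structure IsSmoothClosedCurve (γ : ℝ → ℂ) : Prop where
  smooth : ContDiff ℝ ∞ γ
  periodic : Function.Periodic γ 1
  regular : ∀ t, deriv γ t ≠ 0
  simple : InjOn γ (Ico 0 1)

/-- A connected and simply connected closed planar domain with non-empty interior, bounded by a
smooth closed curve. -/
structure IsSmoothDomain (D : Set ℂ) : Prop where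
  isCompact : IsCompact D
  isConnected : IsConnected D
  simplyConnected : SimplyConnectedSpace D
  interior_nonempty : (interior D).Nonempty
  boundary : ∃ γ : ℝ → ℂ, IsSmoothClosedCurve γ ∧ range γ = frontier D

/-- The derivative of a map `F` on the closed domain `D` (one-sided at boundary points). -/
noncomputable def derivOn (D : Set ℂ) (F : ℂ → ℂ) (z : ℂ) : ℂ →L[ℝ] ℂ := fderivWithin ℝ F D z

/-- The standard area form `dx ∧ dy` on `ℂ = ℝ²`. -/
def area (u v : ℂ) : ℝ := u.re * v.im - u.im * v.re

/-- `F` restricts to a diffeomorphism of `D`, smooth up to the boundary together with its inverse,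
which pulls back the area form to itself. -/
structure IsSymplectomorphism (D : Set ℂ) (F : ℂ → ℂ) : Prop where
  smooth : ContDiffOn ℝ ∞ F D
  mapsTo : MapsTo F D D
  inverse : ∃ G : ℂ → ℂ, ContDiffOn ℝ ∞ G D ∧ MapsTo G D D ∧ InvOn G F D D
  preserves_area : ∀ z ∈ D, ∀ u v, area (derivOn D F z u) (derivOn D F z v) = area u v

/-- The linear map `(z₁, z₂) ↦ (w₁, w₂) = ((z₁ + z₂) / 2, i (z₁ - z₂))` that identifies `ℂ × ℂ`
with the cotangent bundle `T*Δ = ℂ × ℂ` of the diagonal: `w₁` is the base point and `w₂` the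
covector. -/
noncomputable def turn : ℂ × ℂ →ₗ[ℝ] ℂ × ℂ where
  toFun z := ((z.1 + z.2) / 2, Complex.I * (z.1 - z.2))
  map_add' z w := by ext1 <;> simp <;> ring
  map_smul' c z := by ext1 <;> simp <;> ring

/-- The projection of `ℂ × ℂ ≅ T*Δ` to the base; its fibres are the cotangent fibres. -/
noncomputable def cotangentProj : ℂ × ℂ →ₗ[ℝ] ℂ := LinearMap.fst ℝ ℂ ℂ ∘ₗ turn

/-- `F` is moderate on `D`: at each point of the graph of `F` over `D`, the tangent space
`{(v, dF v)}` of the graph and the tangent space of the cotangent fibre span `ℂ × ℂ`. -/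
def IsModerate (D : Set ℂ) (F : ℂ → ℂ) : Prop :=
  ∀ z ∈ D, (derivOn D F z : ℂ →ₗ[ℝ] ℂ).graph ⊔ LinearMap.ker cotangentProj = ⊤

/-- A symplectomorphism is moderate if and only if `2 + f_x + g_y` vanishes nowhere on `D`. -/
theorem IsSymplectomorphism.isModerate_iff {D : Set ℂ} {F : ℂ → ℂ}
    (hF : IsSymplectomorphism D F) : IsModerate D F ↔
      ∀ z ∈ D, 2 + (derivOn D F z 1).re + (derivOn D F z Complex.I).im ≠ 0 := by
  unfold IsModerate
  refine forall₂_congr fun z hz => ?_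
  have hdet := hF.preserves_area z hz 1 Complex.I
  revert hdet
  generalize derivOn D F z = A
  intro hdet
  simp only [area, Complex.one_re, Complex.one_im, Complex.I_re, Complex.I_im] at hdet
  have hA : ∀ v : ℂ, A v = v.re • A 1 + v.im • A Complex.I := fun v => by
    rw [← map_smul, ← map_smul, ← map_add]; congr 1; simp
  constructor
  · intro h h0
    have hs : Function.Injective (fun v : ℂ => v + A v) := by
      have : Function.Surjective ((LinearMap.id + (A : ℂ →ₗ[ℝ] ℂ)) : ℂ →ₗ[ℝ] ℂ) := by
        intro w
        have hw : ((w, 0) : ℂ × ℂ) ∈ (A : ℂ →ₗ[ℝ] ℂ).graph ⊔ LinearMap.ker cotangentProj:= by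
          rw [h]; trivial
        obtain ⟨a, ha, b, hb, hab⟩ := Submodule.mem_sup.1 hw
        have hb' : b.1 + b.2 = 0 := by simpa [cotangentProj, turn] using hb
        rw [LinearMap.mem_graph_iff] at ha
        refine ⟨a.1, ?_⟩
        have h1 := congrArg Prod.fst hab
        have h2 := congrArg Prod.snd hab
        simp at h1 h2 ha ⊢
        rw [← ha]; linear_combination h1 + h2 - hb'
      exact LinearMap.injective_iff_surjective.2 this
    obtain ⟨a, ha⟩ : ∃ a, a = A 1 := ⟨_, rfl⟩
    obtain ⟨b, hb⟩ : ∃ b, b = A Complex.I := ⟨_, rfl⟩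
    rw [← ha, ← hb] at h0 hA hdet
    have k1 := @hs ⟨1 + b.im, -a.im⟩ 0 (by
      simp only [hA ⟨1 + b.im, -a.im⟩, hA 0]
      apply Complex.ext <;> simp <;> linarith)
    have k2 := @hs ⟨-b.re, 1 + a.re⟩ 0 (by
      simp only [hA ⟨-b.re, 1 + a.re⟩, hA 0]
      apply Complex.ext <;> simp <;> linarith)
    have k3 := @hs 1 0 (by
      simp only [hA 1, hA 0]
      have := congrArg Complex.re k1
      have := congrArg Complex.im k1
      have := congrArg Complex.re k2
      have := congrArg Complex.im k2
      apply Complex.ext <;> simp at * <;> linarith)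
    simp at k3
  · intro h
    have hs : Function.Surjective ((LinearMap.id + (A : ℂ →ₗ[ℝ] ℂ)) : ℂ →ₗ[ℝ] ℂ) := by
      rw [← LinearMap.injective_iff_surjective, injective_iff_map_eq_zero]
      intro v hv
      simp only [LinearMap.add_apply, LinearMap.id_apply, ContinuousLinearMap.coe_coe, hA v] at hv
      have h1 := congrArg Complex.re hv
      have h2 := congrArg Complex.im hv
      simp at h1 h2
      apply Complex.ext <;> apply mul_left_cancel₀ h <;>
        simp only [Complex.zero_re, Complex.zero_im, mul_zero]
      · linear_combination (1 + (A Complex.I).im) * h1 - (A Complex.I).re * h2 - v.re * hdet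
      · linear_combination (1 + (A 1).re) * h2 - (A 1).im * h1 - v.im * hdet
    rw [eq_top_iff]
    rintro ⟨p, q⟩ -
    obtain ⟨v, hv⟩ := hs (p + q)
    simp at hv
    refine Submodule.mem_sup.2 ⟨(v, A v), by simp [LinearMap.mem_graph_iff], (p - v, q - A v), ?_,
      by simp⟩
    simp [cotangentProj, turn]; linear_combination -hv

/-- `z` is a conformal point of `F`: the derivative of `F` at `z` is a similarity. -/
def IsConformalPoint (D : Set ℂ) (F : ℂ → ℂ) (z : ℂ) : Prop :=
  IsConformalMap (derivOn D F z)

/-- The vector field `(f_x - g_y) ∂_x + (f_y + g_x) ∂_y` attached to `F = f + i g`. -/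
noncomputable def conformalField (D : Set ℂ) (F : ℂ → ℂ) (z : ℂ) : ℂ :=
  ⟨(derivOn D F z 1).re - (derivOn D F z Complex.I).im,
    (derivOn D F z Complex.I).re + (derivOn D F z 1).im⟩

/-- The loop `c : [0, 2π] → ℂ ∖ {0}` has rotation number `n`: it has a continuous choice of
argument, and this argument increases by `2πn`. -/
def HasRotationNumber (c : ℝ → ℂ) (n : ℤ) : Prop :=
  ∃ θ : ℝ → ℝ, ContinuousOn θ (Icc 0 (2 * Real.pi)) ∧
    (∀ t ∈ Icc 0 (2 * Real.pi), c t ≠ 0 ∧ c t = ‖c t‖ * Complex.exp (θ t * Complex.I)) ∧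
    θ (2 * Real.pi) - θ 0 = 2 * Real.pi * n

/-- The index of the planar vector field `V` at `z` is `n`: along all sufficiently small
counterclockwise circles around `z`, the field `V` has no zeros and rotation number `n`. -/
def HasIndex (V : ℂ → ℂ) (z : ℂ) (n : ℤ) : Prop :=
  ∀ᶠ r : ℝ in 𝓝[>] 0, HasRotationNumber (fun t => V (circleMap z r t)) n

/-- The multiplicity of an isolated conformal point: the index of the vector field
`conformalField`, whose zeros are the conformal points. -/
def HasMultiplicity (D : Set ℂ) (F : ℂ → ℂ) (z : ℂ) (n : ℤ) : Prop :=
  HasIndex (conformalField D F) z n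

end ConformalPoints

/-! The conformal field is `V = dF(1) + i dF(i)`, twice the antiholomorphic derivative of `F`. The
proof compares two computations of its winding number along the boundary curve `γ`.

On `γ` the map is the identity, so `dF` fixes the tangent `τ = γ'`. Being area-preserving, it is a
shear along `τ`, and hence `V = ρ i τ²` with `ρ` real (`shear_field`). Without conformal points on
`γ`, `ρ` never vanishes and contributes no winding. So `V` winds `2w` times, where `w` is the
rotation number of `γ'` (`IsCollar.hasWinding_conformalField`).

On the other hand, if `V` has finitely many zeros, its winding along `γ` is the sum of their indices
times the winding number of `γ` around interior points (`HasWinding.of_localWinding`). That winding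
number is again `w` (`IsCollar.hasWinding_sub`, Hopf's argument on the torus of pairs of
parameters). It is nonzero (`not_hasWinding_frontier`, a no-retraction argument). Cancelling `w`
shows that the indices add up to exactly 2, and the orientation of `γ` never has to be determined.

The planar topology comes from normal coordinates along `γ`: `exists_collar` separates the inner
from the outer side without the Jordan curve theorem. The collar makes `D` locally path connected,
so that simple connectedness yields logarithms on `D`. -/

namespace ConformalPoints

/-! ### Continuous logarithms and winding numbers of periodic loops -/

theorem exists_continuous_log {X : Type*} [TopologicalSpace X] [SimplyConnectedSpace X]
    [LocallyPathConnectedSpace X] {f : X → ℂ} (hf : Continuous f) (h0 : ∀ x, f x ≠ 0) :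
    ∃ l : X → ℂ, Continuous l ∧ ∀ x, Complex.exp (l x) = f x := by
  obtain ⟨x₀⟩ : Nonempty X := inferInstance
  obtain ⟨l, ⟨-, hl⟩, -⟩ := Complex.isCoveringMapOn_exp.existsUnique_continuousMap_lifts
    ⟨f, hf⟩ (Complex.exp_log (h0 x₀)) (fun x => h0 x)
  exact ⟨l, l.continuous, fun x => congrFun hl x⟩

/-- Two logarithms of the same function differ in this way, so their difference is constant. -/
theorem exists_int_of_continuous {X : Type*} [TopologicalSpace X] [PreconnectedSpace X]
    {g : X → ℂ} (hg : Continuous g) (h : ∀ x, ∃ n : ℤ, g x = n * (2 * Real.pi * Complex.I)) :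
    ∃ n : ℤ, ∀ x, g x = n * (2 * Real.pi * Complex.I) := by
  choose n hn using h
  have hc : Continuous n := by
    rw [Int.isClosedEmbedding_coe_real.isInducing.continuous_iff]
    have : ((↑) : ℤ → ℝ) ∘ n = fun x => (g x / (2 * Real.pi * Complex.I)).re := by
      ext x
      rw [hn x, mul_div_cancel_right₀ _ Complex.two_pi_I_ne_zero]
      simp
    rw [this]
    exact Complex.continuous_re.comp (hg.div_const _)
  rcases isEmpty_or_nonempty X with hX | ⟨⟨x₀⟩⟩
  · exact ⟨0, fun x => isEmptyElim x⟩
  · exact ⟨n x₀, fun x => by rw [hn x, PreconnectedSpace.constant ‹_› hc (x := x) (y := x₀)]⟩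

/-- The `1`-periodic loop `c` in `ℂ ∖ {0}` has winding number `n` around the origin: it has a
continuous logarithm, which increases by `2πi n` over a period. -/
def HasWinding (c : ℝ → ℂ) (n : ℤ) : Prop :=
  ∃ l : ℝ → ℂ, Continuous l ∧ (∀ t, Complex.exp (l t) = c t) ∧
    ∀ t, l (t + 1) = l t + n * (2 * Real.pi * Complex.I)

namespace HasWinding

variable {c d : ℝ → ℂ} {m n : ℤ}

theorem ne_zero (h : HasWinding c n) (t : ℝ) : c t ≠ 0 := by
  obtain ⟨l, -, h, -⟩ := h
  exact h t ▸ Complex.exp_ne_zero _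

theorem continuous (h : HasWinding c n) : Continuous c := by
  obtain ⟨l, hl, h, -⟩ := h
  rw [← funext h]
  fun_prop

theorem periodic (h : HasWinding c n) : Function.Periodic c 1 := fun t => by
  obtain ⟨l, -, h, hp⟩ := h
  rw [← h, ← h, hp, Complex.exp_add, Complex.exp_int_mul_two_pi_mul_I, mul_one]

theorem unique (hm : HasWinding c m) (hn : HasWinding c n) : m = n := by
  obtain ⟨l, hl, hlc, hlp⟩ := hm
  obtain ⟨k, hk, hkc, hkp⟩ := hn
  obtain ⟨j, hj⟩ := exists_int_of_continuous (hl.sub hk) fun t => by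
    obtain ⟨j, hj⟩ := Complex.exp_eq_exp_iff_exists_int.1 ((hlc t).trans (hkc t).symm)
    exact ⟨j, by simp only [Pi.sub_apply, hj]; ring⟩
  have h0 := hj 0
  have h1 := hj 1
  simp only [Pi.sub_apply] at h0 h1
  have hl0 := hlp 0
  have hk0 := hkp 0
  rw [zero_add] at hl0 hk0
  have : ((m : ℂ) - n) * (2 * Real.pi * Complex.I) = 0 := by
    linear_combination h1 - h0 - hl0 + hk0
  rcases mul_eq_zero.1 this with h | h
  · exact_mod_cast sub_eq_zero.1 h
  · exact absurd h Complex.two_pi_I_ne_zero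

theorem mul (hm : HasWinding c m) (hn : HasWinding d n) :
    HasWinding (fun t => c t * d t) (m + n) := by
  obtain ⟨l, hl, hlc, hlp⟩ := hm
  obtain ⟨k, hk, hkc, hkp⟩ := hn
  refine ⟨l + k, hl.add hk, fun t => ?_, fun t => ?_⟩
  · simp [Complex.exp_add, hlc, hkc]
  · simp only [Pi.add_apply, hlp, hkp, Int.cast_add]; ring

theorem zpow (hm : HasWinding c m) (k : ℤ) : HasWinding (fun t => c t ^ k) (k * m) := by
  obtain ⟨l, hl, hlc, hlp⟩ := hm
  refine ⟨fun t => k * l t, by fun_prop, fun t => ?_, fun t => ?_⟩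
  · rw [Complex.exp_int_mul, hlc]
  · simp only [hlp]; push_cast; ring

theorem const {a : ℂ} (ha : a ≠ 0) : HasWinding (fun _ => a) 0 :=
  ⟨fun _ => Complex.log a, continuous_const, fun _ => Complex.exp_log ha, fun t => by simp⟩

theorem of_log {l : ℝ → ℂ} (hl : Continuous l) (hp : Function.Periodic l 1) :
    HasWinding (fun t => Complex.exp (l t)) 0 :=
  ⟨l, hl, fun _ => rfl, fun t => by simp [hp t]⟩

/-- Rouché's argument: `d / c` stays in the disc of radius 1 around 1, where the principal logarithm
is continuous, so the quotient does not wind. -/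
theorem of_norm_sub_lt (hc : HasWinding c n) (hd : Continuous d) (hp : Function.Periodic d 1)
    (h : ∀ t, ‖d t - c t‖ < ‖c t‖) : HasWinding d n := by
  have hs : ∀ t, d t / c t ∈ Complex.slitPlane := fun t => by
    have h0 := hc.ne_zero t
    have : d t / c t = 1 + (d t - c t) / c t := by field_simp; ring
    rw [this]
    refine Complex.mem_slitPlane_of_norm_lt_one ?_
    rw [norm_div, div_lt_one (norm_pos_iff.2 h0)]
    exact h t
  have hq : HasWinding (fun t => Complex.exp (Complex.log (d t / c t))) 0 := by
    refine of_log ((hd.div hc.continuous hc.ne_zero).clog hs) fun t => ?_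
    simp only [hc.periodic t, hp t]
  have := hc.mul hq
  rw [add_zero] at this
  convert this using 2 with t
  rw [Complex.exp_log (Complex.slitPlane_ne_zero (hs t)), mul_div_cancel₀ _ (hc.ne_zero t)]

end HasWinding

theorem exists_hasWinding {c : ℝ → ℂ} (hc : Continuous c) (hp : Function.Periodic c 1)
    (h0 : ∀ t, c t ≠ 0) : ∃ n, HasWinding c n := by
  obtain ⟨l, hl, hlc⟩ := exists_continuous_log hc h0
  obtain ⟨n, hn⟩ := exists_int_of_continuous (g := fun t => l (t + 1) - l t) (by fun_prop)
    fun t => by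
      obtain ⟨j, hj⟩ := Complex.exp_eq_exp_iff_exists_int.1
        (((hlc (t + 1)).trans (hp t)).trans (hlc t).symm)
      exact ⟨j, by rw [hj]; ring⟩
  exact ⟨n, l, hl, hlc, fun t => by rw [← hn t]; ring⟩

/-- Homotopy invariance of the winding number. -/
theorem HasWinding.of_homotopy {X : Type*} [TopologicalSpace X] [PreconnectedSpace X]
    {H : X → ℝ → ℂ} (hH : Continuous fun p : X × ℝ => H p.1 p.2)
    (hp : ∀ x, Function.Periodic (H x) 1) (h0 : ∀ x t, H x t ≠ 0) {x y : X} {n : ℤ}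
    (hx : HasWinding (H x) n) : HasWinding (H y) n := by
  have hc : ∀ x, Continuous (H x) := fun x => hH.comp (by fun_prop : Continuous fun t => (x, t))
  choose w hw using fun x => exists_hasWinding (hc x) (hp x) (h0 x)
  have hloc : IsLocallyConstant w := by
    rw [IsLocallyConstant.iff_eventually_eq]
    intro x
    -- Compactness of one period gives uniform closeness; by Rouché the winding number is then
    -- locally constant.
    have hev : ∀ᶠ z in 𝓝 x, ∀ t ∈ Icc (0 : ℝ) 1, ‖H z t - H x t‖ < ‖H x t‖ := by
      refine isCompact_Icc.eventually_forall_of_forall_eventually fun t _ => ?_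
      have h1 : Continuous fun p : X × ℝ => ‖H p.1 p.2 - H x p.2‖ :=
        (hH.sub ((hc x).comp continuous_snd)).norm
      have h2 : Continuous fun p : X × ℝ => ‖H x p.2‖ := ((hc x).comp continuous_snd).norm
      refine (h1.tendsto (x, t)).eventually_lt (h2.tendsto (x, t)) ?_
      simpa using h0 x t
    filter_upwards [hev] with z hz
    refine (hw z).unique ((hw x).of_norm_sub_lt (hc z) (hp z) fun t => ?_)
    have hper : Function.Periodic (fun t => ‖H x t‖ - ‖H z t - H x t‖) 1 := fun t => by
      simp only [hp x t, hp z t]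
    obtain ⟨s, hs, hst⟩ := hper.exists_mem_Ico₀ one_pos t
    have := hz s ⟨hs.1, hs.2.le⟩
    linarith
  rw [hx.unique (hw x), hloc.apply_eq_of_isPreconnected isPreconnected_univ (mem_univ x)
    (mem_univ y)]
  exact hw y

/-- The winding number along the diagonal of a torus is the sum of those along the factors. -/
theorem HasWinding.diagonal {H : ℝ → ℝ → ℂ} (hH : Continuous fun p : ℝ × ℝ => H p.1 p.2)
    (h0 : ∀ s t, H s t ≠ 0) {m n : ℤ} (hm : HasWinding (fun s => H s 0) m)
    (hn : HasWinding (fun t => H 0 t) n) (hp₁ : ∀ s t, H (s + 1) t = H s t)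
    (hp₂ : ∀ s t, H s (t + 1) = H s t) : HasWinding (fun t => H t t) (m + n) := by
  -- The logarithm lives on the universal cover of the torus. Its increments under the two unit
  -- translations are constants, and the diagonal translation is their composition.
  obtain ⟨L, hL, hLH⟩ := exists_continuous_log hH fun p => h0 p.1 p.2
  obtain ⟨a, ha⟩ := exists_int_of_continuous
    (g := fun p : ℝ × ℝ => L (p.1 + 1, p.2) - L p) (by fun_prop) fun p => by
      obtain ⟨j, hj⟩ := Complex.exp_eq_exp_iff_exists_int.1
        (((hLH (p.1 + 1, p.2)).trans (hp₁ _ _)).trans (hLH p).symm)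
      exact ⟨j, by rw [hj]; ring⟩
  obtain ⟨b, hb⟩ := exists_int_of_continuous
    (g := fun p : ℝ × ℝ => L (p.1, p.2 + 1) - L p) (by fun_prop) fun p => by
      obtain ⟨j, hj⟩ := Complex.exp_eq_exp_iff_exists_int.1
        (((hLH (p.1, p.2 + 1)).trans (hp₂ _ _)).trans (hLH p).symm)
      exact ⟨j, by rw [hj]; ring⟩
  have hma : m = a := hm.unique ⟨fun s => L (s, 0), by fun_prop, fun s => hLH (s, 0),
    fun s => by rw [← ha (s, 0)]; ring⟩
  have hnb : n = b := hn.unique ⟨fun t => L (0, t), by fun_prop, fun t => hLH (0, t),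
    fun t => by rw [← hb (0, t)]; ring⟩
  refine ⟨fun t => L (t, t), by fun_prop, fun t => hLH (t, t), fun t => ?_⟩
  have h1 := ha (t, t + 1)
  have h2 := hb (t, t)
  simp only at h1 h2
  rw [hma, hnb, Int.cast_add, add_mul, ← h1, ← h2]
  ring

/-- A nonvanishing function with winding number zero along a simple closed curve has a logarithm
on the curve, which extends continuously to the plane. -/
theorem exists_log_extension {γ : ℝ → ℂ} (hγ : Continuous γ) (hp : Function.Periodic γ 1)
    (hinj : InjOn γ (Ico 0 1)) {f : ℂ → ℂ} (hf : HasWinding (fun t => f (γ t)) 0) :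
    ∃ E : ℂ → ℂ, Continuous E ∧ ∀ t, Complex.exp (E (γ t)) = f (γ t) := by
  obtain ⟨l, hl, hlf, hlp⟩ := hf
  have hlper : Function.Periodic l 1 := fun t => by simpa using hlp t
  have hpair : Function.Periodic (fun t => (γ t, l t)) 1 := fun t => by simp only [hp t, hlper t]
  have hfac : ∀ s t, γ s = γ t → l s = l t := fun s t hst => by
    obtain ⟨s', hs', hs⟩ := hpair.exists_mem_Ico₀ one_pos s
    obtain ⟨t', ht', ht⟩ := hpair.exists_mem_Ico₀ one_pos t
    rw [Prod.mk.injEq] at hs ht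
    rw [hs.2, ht.2, hinj hs' ht' (hs.1.symm.trans (hst.trans ht.1))]
  have hrange : γ '' Icc 0 1 = range γ := by
    simpa using hp.image_Icc one_pos 0
  have hclosed : IsClosed (range γ) := hrange ▸ (isCompact_Icc.image hγ).isClosed
  let q : C(Icc (0 : ℝ) 1, range γ) := ⟨fun t => ⟨γ t, mem_range_self _⟩, by fun_prop⟩
  -- A surjection from a compact space to a Hausdorff one is a quotient map, so the periodic
  -- logarithm descends to the curve; Tietze's theorem then extends it.
  have hq : IsQuotientMap q := by
    refine q.continuous.isClosedMap.isQuotientMap q.continuous fun ⟨z, hz⟩ => ?_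
    obtain ⟨t, ht, htz⟩ := hrange.symm ▸ hz
    exact ⟨⟨t, ht⟩, Subtype.ext htz⟩
  let g : C(Icc (0 : ℝ) 1, ℂ) := ⟨fun t => l t, by fun_prop⟩
  have hg : Function.FactorsThrough g q := fun s t hst => hfac s t (congrArg Subtype.val hst)
  obtain ⟨E, hE⟩ := ContinuousMap.exists_extension hclosed.isClosedEmbedding_subtypeVal
    (hq.lift g hg)
  refine ⟨E, E.continuous, fun t => ?_⟩
  obtain ⟨s, hs, hst⟩ := hpair.exists_mem_Ico₀ one_pos t
  rw [Prod.mk.injEq] at hst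
  have h1 : E (γ s) = hq.lift g hg (q ⟨s, hs.1, hs.2.le⟩) := 
    DFunLike.congr_fun hE (q ⟨s, hs.1, hs.2.le⟩)
  have h2 : hq.lift g hg (q ⟨s, hs.1, hs.2.le⟩) = l s :=
    DFunLike.congr_fun (hq.lift_comp g hg) ⟨s, hs.1, hs.2.le⟩
  rw [hst.1, h1, h2]
  exact hlf s

/-! ### Local winding numbers and their sum -/

/-- The circle of radius `r` around `p`, as a `1`-periodic loop. -/
noncomputable def loopAround (p : ℂ) (r : ℝ) (t : ℝ) : ℂ := circleMap p r (2 * Real.pi * t)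

theorem continuous_loopAround (p : ℂ) :
    Continuous fun x : ℝ × ℝ => loopAround p x.1 x.2 := by
  unfold loopAround circleMap
  fun_prop

theorem loopAround_periodic (p : ℂ) (r : ℝ) : Function.Periodic (loopAround p r) 1 := fun t => by
  rw [loopAround, loopAround, mul_add, mul_one]
  exact periodic_circleMap p r _

theorem dist_loopAround (p : ℂ) {r : ℝ} (hr : 0 ≤ r) (t : ℝ) : dist (loopAround p r t) p = r := by
  rw [loopAround, dist_eq_norm, circleMap_sub_center, norm_circleMap_zero, abs_of_nonneg hr]

theorem range_loopAround (p : ℂ) {r : ℝ} (hr : 0 ≤ r) :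
    range (loopAround p r) = Metric.sphere p r := by
  rw [← abs_of_nonneg hr, ← range_circleMap, abs_of_nonneg hr]
  ext z
  constructor
  · rintro ⟨t, rfl⟩; exact ⟨_, rfl⟩
  · rintro ⟨t, rfl⟩
    refine ⟨t / (2 * Real.pi), ?_⟩
    rw [loopAround, mul_div_cancel₀ _ Real.two_pi_pos.ne']

theorem injOn_loopAround (p : ℂ) {r : ℝ} (hr : 0 < r) : InjOn (loopAround p r) (Ico 0 1) := by
  intro s hs t ht hst
  have hπ := Real.two_pi_pos
  have h := injOn_circleMap_of_abs_sub_le' (c := p) (a := 0) (b := 2 * Real.pi) hr.ne' (by simp)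
    (show 2 * Real.pi * s ∈ Ico 0 (2 * Real.pi) from
      ⟨mul_nonneg hπ.le hs.1, mul_lt_of_lt_one_right hπ hs.2⟩)
    (show 2 * Real.pi * t ∈ Ico 0 (2 * Real.pi) from
      ⟨mul_nonneg hπ.le ht.1, mul_lt_of_lt_one_right hπ ht.2⟩) hst
  exact mul_left_cancel₀ hπ.ne' h

/-- Along all sufficiently small circles around `p`, the winding number of `f` is `n`. -/
def HasLocalWinding (f : ℂ → ℂ) (p : ℂ) (n : ℤ) : Prop :=
  ∀ᶠ r : ℝ in 𝓝[>] 0, HasWinding (fun t => f (loopAround p r t)) n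

namespace HasLocalWinding

variable {f g : ℂ → ℂ} {p q : ℂ} {m n : ℤ}

theorem mul (hf : HasLocalWinding f p m) (hg : HasLocalWinding g p n) :
    HasLocalWinding (fun z => f z * g z) p (m + n) := by
  filter_upwards [hf, hg] with r h1 h2 using h1.mul h2

theorem zpow (hf : HasLocalWinding f p m) (k : ℤ) :
    HasLocalWinding (fun z => f z ^ k) p (k * m) := by
  filter_upwards [hf] with r h1 using h1.zpow k

theorem sub_self (p : ℂ) : HasLocalWinding (fun z => z - p) p 1 := by
  filter_upwards [self_mem_nhdsWithin] with r hr
  have hr : (r : ℂ) ≠ 0 := by exact_mod_cast (mem_Ioi.1 hr).ne'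
  refine ⟨fun t => Complex.log r + t * (2 * Real.pi * Complex.I), by fun_prop, fun t => ?_,
    fun t => ?_⟩
  · beta_reduce
    rw [loopAround, circleMap_sub_center, circleMap_zero, Complex.exp_add, Complex.exp_log hr]
    push_cast
    ring_nf
  · push_cast; ring

theorem sub_of_ne (h : p ≠ q) : HasLocalWinding (fun z => z - q) p 0 := by
  have hpos : 0 < ‖p - q‖ := norm_pos_iff.2 (sub_ne_zero.2 h)
  filter_upwards [Ioo_mem_nhdsGT hpos] with r hr
  refine (HasWinding.const (sub_ne_zero.2 h)).of_norm_sub_lt ?_ ?_ fun t => ?_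
  · exact ((continuous_loopAround p).comp (by fun_prop : Continuous fun t : ℝ => (r, t))).sub
      continuous_const
  · intro t; simp only [loopAround_periodic p r t]
  · rw [sub_sub_sub_cancel_right, ← dist_eq_norm, dist_loopAround p hr.1.le]
    exact hr.2

theorem hasIndex (h : HasLocalWinding f p n) : HasIndex f p n := by
  filter_upwards [h] with r hr
  obtain ⟨l, hl, hlf, hlp⟩ := hr
  have hlf' : ∀ t, Complex.exp (l (t / (2 * Real.pi))) = f (circleMap p r t) := fun t => by
    simp only [hlf, loopAround]
    rw [mul_div_cancel₀ _ Real.two_pi_pos.ne']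
  refine ⟨fun t => (l (t / (2 * Real.pi))).im, by fun_prop, fun t _ => ⟨?_, ?_⟩, ?_⟩
  · simp only [← hlf']; exact Complex.exp_ne_zero _
  · simp only [← hlf']
    rw [Complex.norm_exp, Complex.ofReal_exp, ← Complex.exp_add, Complex.re_add_im]
  · have := congrArg Complex.im (hlp 0)
    rw [zero_add] at this
    simp only [div_self Real.two_pi_pos.ne', zero_div, this]
    simp
    ring

end HasLocalWinding

/-- Concentric circles are homotopic in the punctured disc, with the radius as parameter. -/
theorem HasWinding.loopAround_of_mem_Ioo {f : ℂ → ℂ} {p : ℂ} {R : ℝ}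
    (hf : ContinuousOn f (Metric.ball p R \ {p})) (h0 : ∀ z ∈ Metric.ball p R \ {p}, f z ≠ 0)
    {r ρ : ℝ} (hr : r ∈ Ioo 0 R) (hρ : ρ ∈ Ioo 0 R) {n : ℤ}
    (h : HasWinding (fun t => f (loopAround p r t)) n) :
    HasWinding (fun t => f (loopAround p ρ t)) n := by
  have : PreconnectedSpace (Ioo 0 R) := Subtype.preconnectedSpace isPreconnected_Ioo
  have hmem : ∀ x : Ioo 0 R, ∀ t, loopAround p x t ∈ Metric.ball p R \ {p} := fun x t => by
    have := dist_loopAround p x.2.1.le t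
    refine ⟨by rw [Metric.mem_ball, this]; exact x.2.2, fun h => ?_⟩
    rw [mem_singleton_iff.1 h, dist_self] at this
    exact x.2.1.ne this
  exact HasWinding.of_homotopy (H := fun (x : Ioo 0 R) t => f (loopAround p x t))
    (hf.comp_continuous ((continuous_loopAround p).comp (by fun_prop :
      Continuous fun y : Ioo 0 R × ℝ => ((y.1 : ℝ), y.2))) fun y => hmem y.1 y.2)
    (fun x t => by simp only [loopAround_periodic p x t]) (fun x t => h0 _ (hmem x t))
    (x := ⟨r, hr⟩) (y := ⟨ρ, hρ⟩) h

theorem exists_hasLocalWinding {f : ℂ → ℂ} {p : ℂ} {R : ℝ} (hR : 0 < R)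
    (hf : ContinuousOn f (Metric.ball p R \ {p})) (h0 : ∀ z ∈ Metric.ball p R \ {p}, f z ≠ 0) :
    ∃ n, HasLocalWinding f p n := by
  have hmem : ∀ t, loopAround p (R / 2) t ∈ Metric.ball p R \ {p} := fun t => by
    have := dist_loopAround p (half_pos hR).le t
    refine ⟨by rw [Metric.mem_ball, this]; linarith, fun h => ?_⟩
    rw [mem_singleton_iff.1 h, dist_self] at this
    linarith
  obtain ⟨n, hn⟩ := exists_hasWinding (c := fun t => f (loopAround p (R / 2) t))
    (hf.comp_continuous ((continuous_loopAround p).comp (by fun_prop :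
      Continuous fun t : ℝ => (R / 2, t))) hmem)
    (fun t => by simp only [loopAround_periodic p _ t]) (fun t => h0 _ (hmem t))
  refine ⟨n, ?_⟩
  filter_upwards [Ioo_mem_nhdsGT hR] with r hr
  exact hn.loopAround_of_mem_Ioo hf h0 ⟨half_pos hR, by linarith⟩ hr

/-- The winding number of `f` along the boundary of `D` is determined by the local winding numbers
at the finitely many zeros of `f` in the interior. -/
theorem HasWinding.of_localWinding {D : Set ℂ}
    (hlog : ∀ f : ℂ → ℂ, ContinuousOn f D → (∀ z ∈ D, f z ≠ 0) →
      ∃ l : ℂ → ℂ, ContinuousOn l D ∧ ∀ z ∈ D, Complex.exp (l z) = f z)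
    {γ : ℝ → ℂ} (hγ : Continuous γ) (hp : Function.Periodic γ 1) (hγD : ∀ t, γ t ∈ D)
    (hγi : ∀ t, γ t ∉ interior D) {w : ℤ}
    (hw : ∀ p ∈ interior D, HasWinding (fun t => γ t - p) w) (m : ℂ → ℤ) (s : Finset ℂ) :
    ∀ f : ℂ → ℂ, ↑s ⊆ interior D → ContinuousOn f (D \ s) → (∀ z ∈ D \ s, f z ≠ 0) →
      (∀ p ∈ s, HasLocalWinding f p (m p)) →
      HasWinding (fun t => f (γ t)) ((∑ p ∈ s, m p) * w) := by
  classical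
  induction s using Finset.induction_on with
  | empty =>
    intro f _ hf h0 _
    simp only [Finset.coe_empty, sdiff_empty] at hf h0
    obtain ⟨l, hl, hlf⟩ := hlog f hf h0
    have := HasWinding.of_log (l := fun t => l (γ t)) (hl.comp_continuous hγ hγD)
      fun t => by simp only [hp t]
    simpa [hlf _ (hγD _)] using this
  | insert p s hps ih =>
    intro f hs hf h0 hm
    have hpi : p ∈ interior D := hs (by simp)
    obtain ⟨R, hR, hball⟩ := Metric.isOpen_iff.1 (isOpen_interior.sdiff s.finite_toSet.isClosed) p
      ⟨hpi, by simpa using hps⟩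
    have hrR : R / 2 ∈ Ioo 0 R := ⟨half_pos hR, by linarith⟩
    -- Dividing by this power removes the winding around `p`.
    set h : ℂ → ℂ := fun z => f z * (z - p) ^ (-m p) with hh
    have hsub : ∀ z ∈ D \ ↑(insert p s), z - p ≠ 0 := fun z hz h => hz.2 (by
      simp [sub_eq_zero.1 h])
    have hhc : ContinuousOn h (D \ ↑(insert p s)) :=
      hf.mul ((continuousOn_id.sub continuousOn_const).zpow₀ _ fun z hz => .inl (hsub z hz))
    have hh0 : ∀ z ∈ D \ ↑(insert p s), h z ≠ 0 := fun z hz =>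
      mul_ne_zero (h0 z hz) (zpow_ne_zero _ (hsub z hz))
    have hballD : Metric.ball p R \ {p} ⊆ D \ ↑(insert p s) := fun z hz =>
      ⟨interior_subset (hball hz.1).1, by
        have := (hball hz.1).2
        simp only [Finset.coe_insert, mem_insert_iff, not_or]
        exact ⟨hz.2, this⟩⟩
    have hhp : HasLocalWinding h p 0 := by
      have := (hm p (by simp)).mul ((HasLocalWinding.sub_self p).zpow (-m p))
      rwa [mul_one, add_neg_cancel] at this
    have hhr : HasWinding (fun t => h (loopAround p (R / 2) t)) 0 := by
      obtain ⟨r, h1, h2⟩ := (hhp.and (Ioo_mem_nhdsGT hR)).exists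
      exact h1.loopAround_of_mem_Ioo (hhc.mono hballD) (fun z hz => hh0 z (hballD hz)) h2 hrR
    obtain ⟨E, hE, hEh⟩ := exists_log_extension
      ((continuous_loopAround p).comp (by fun_prop : Continuous fun t : ℝ => (R / 2, t)))
      (loopAround_periodic p (R / 2)) (injOn_loopAround p hrR.1) hhr
    -- Since `h` does not wind along the circle, it can be refilled inside by a nonvanishing
    -- function. This erases the zero `p` and leaves the boundary and the other zeros untouched.
    set g : ℂ → ℂ := (Metric.closedBall p (R / 2)).piecewise (fun z => Complex.exp (E z)) h with hg
    have hgh : ∀ z, R / 2 < dist z p → g z = h z := fun z hz => by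
      rw [hg, piecewise_eq_of_notMem]
      simpa using hz
    have hout : ∀ z ∈ D \ ↑s, R / 2 ≤ dist z p → z ∈ D \ ↑(insert p s) := fun z hz hd => by
      refine ⟨hz.1, ?_⟩
      simp only [Finset.coe_insert, mem_insert_iff, not_or]
      refine ⟨?_, hz.2⟩
      rintro rfl
      rw [dist_self] at hd
      linarith
    have hgc : ContinuousOn g (D \ s) := by
      refine ContinuousOn.piecewise ?_ (by fun_prop) (hhc.mono ?_)
      · rintro z ⟨-, hz⟩
        rw [frontier_closedBall p hrR.1.ne', ← range_loopAround p hrR.1.le] at hz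
        obtain ⟨t, rfl⟩ := hz
        exact hEh t
      · rintro z ⟨hz, hzc⟩
        refine hout z hz ?_
        have : closure (Metric.closedBall p (R / 2))ᶜ ⊆ {z | R / 2 ≤ dist z p} := by
          refine closure_minimal (fun z hz => ?_) (isClosed_le (by fun_prop) (by fun_prop))
          simp only [mem_compl_iff, Metric.mem_closedBall, not_le] at hz
          exact hz.le
        exact this hzc
    have hg0 : ∀ z ∈ D \ s, g z ≠ 0 := fun z hz => by
      by_cases hzb : z ∈ Metric.closedBall p (R / 2)
      · rw [hg, piecewise_eq_of_mem _ _ _ hzb]; exact Complex.exp_ne_zero _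
      · rw [hg, piecewise_eq_of_notMem _ _ _ hzb]
        refine hh0 z (hout z hz ?_)
        simp only [Metric.mem_closedBall, not_le] at hzb
        exact hzb.le
    have hgm : ∀ q ∈ s, HasLocalWinding g q (m q) := fun q hq => by
      have hqp : q ≠ p := fun h => hps (h ▸ hq)
      have hqR : R ≤ dist q p := by
        by_contra hlt
        exact (hball (Metric.mem_ball.2 (not_le.1 hlt))).2 hq
      have h1 := (hm q (by simp [hq])).mul ((HasLocalWinding.sub_of_ne hqp).zpow (-m p))
      rw [mul_zero, add_zero] at h1
      filter_upwards [h1, Ioo_mem_nhdsGT hrR.1] with r h2 hr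
      convert h2 using 2 with t
      refine hgh _ ?_
      have h3 := dist_loopAround q hr.1.le t
      have h4 := dist_triangle_left q p (loopAround q r t)
      have h5 := hr.2
      linarith
    have hgw := (ih g (fun z hz => hs (by simp [Finset.mem_coe.1 hz])) hgc hg0 hgm).mul
      ((hw p hpi).zpow (m p))
    rw [Finset.sum_insert hps, add_comm (m p), add_mul]
    convert hgw using 2 with t
    have hne : γ t - p ≠ 0 := fun h => hγi t (by rwa [sub_eq_zero.1 h])
    rw [hgh, hh, mul_assoc, ← zpow_add₀ hne, neg_add_cancel, zpow_zero, mul_one]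
    by_contra hle
    refine hγi t (hball (Metric.mem_ball.2 ?_)).1
    linarith [not_lt.1 hle]

/-- The boundary of a bounded domain winds around its interior points. -/
theorem not_hasWinding_frontier {D : Set ℂ} (hD : IsCompact D) {γ : ℝ → ℂ} (hγ : Continuous γ)
    (hp : Function.Periodic γ 1) (hinj : InjOn γ (Ico 0 1)) (hr : range γ = frontier D)
    {p : ℂ} (hpD : p ∈ interior D) : ¬ HasWinding (fun t => γ t - p) 0 := by
  classical
  intro hw
  obtain ⟨E, hE, hEγ⟩ := exists_log_extension hγ hp hinj (f := fun z => z - p) hw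
  -- If `γ` did not wind around `p`, then `z - p` outside `D` would extend to a nonvanishing
  -- function on the plane. Contracting a large circle to `p` contradicts its winding number 1.
  set g : ℂ → ℂ := D.piecewise (fun z => Complex.exp (E z)) (fun z => z - p) with hg
  have hgc : Continuous g := by
    refine Continuous.piecewise (fun z hz => ?_) (by fun_prop) (by fun_prop)
    rw [← hr] at hz
    obtain ⟨t, rfl⟩ := hz
    exact hEγ t
  have hg0 : ∀ z, g z ≠ 0 := fun z => by
    by_cases hz : z ∈ D
    · rw [hg, piecewise_eq_of_mem _ _ _ hz]; exact Complex.exp_ne_zero _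
    · rw [hg, piecewise_eq_of_notMem _ _ _ hz]
      exact sub_ne_zero.2 fun h => hz (h ▸ interior_subset hpD)
  obtain ⟨R, hR⟩ := hD.isBounded.subset_ball p
  have hpos : 0 < R := Metric.pos_of_mem_ball (hR (interior_subset hpD))
  have h1 : HasWinding (fun t => g (loopAround p R t)) 0 :=
    HasWinding.of_homotopy (H := fun (r : ℝ) t => g (loopAround p r t))
      (hgc.comp (continuous_loopAround p)) (fun r t => by simp only [loopAround_periodic p r t])
      (fun r t => hg0 _) (x := 0) (y := R)
      (by simpa [loopAround] using HasWinding.const (hg0 p))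
  have h2 : HasWinding (fun t => loopAround p R t - p) 0 := by
    convert h1 using 2 with t
    rw [hg, piecewise_eq_of_notMem]
    intro h
    have := Metric.mem_ball.1 (hR h)
    rw [dist_loopAround p hpos.le] at this
    exact this.false
  obtain ⟨r, h3, hr⟩ := ((HasLocalWinding.sub_self p).and self_mem_nhdsWithin).exists
  have hr : 0 < r := hr
  -- The outer radius only has to exceed both radii that are compared.
  have h4 := h3.loopAround_of_mem_Ioo (f := fun z => z - p) (R := max r R + 1) (by fun_prop)
    (fun z hz => sub_ne_zero.2 hz.2) ⟨hr, by linarith [le_max_left r R]⟩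
    (ρ := R) ⟨hpos, by linarith [le_max_right r R]⟩
  exact absurd (h4.unique h2) one_ne_zero

/-! ### A collar of the boundary curve -/

/-- The point at (signed) normal distance `x.2` from `γ x.1`, measured in units of the speed. -/
noncomputable def normalOffset (γ : ℝ → ℂ) (x : ℝ × ℝ) : ℂ :=
  γ x.1 + x.2 * (Complex.I * deriv γ x.1)

namespace IsSmoothClosedCurve

variable {γ : ℝ → ℂ}

theorem continuous (h : IsSmoothClosedCurve γ) : Continuous γ := h.smooth.continuous

theorem hasDerivAt (h : IsSmoothClosedCurve γ) (t : ℝ) : HasDerivAt γ (deriv γ t) t :=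
  (h.smooth.differentiable (by simp) t).hasDerivAt

theorem contDiff_deriv (h : IsSmoothClosedCurve γ) : ContDiff ℝ ∞ (deriv γ) :=
  (contDiff_infty_iff_deriv.1 h.smooth).2

theorem continuous_deriv (h : IsSmoothClosedCurve γ) : Continuous (deriv γ) :=
  h.contDiff_deriv.continuous

theorem periodic_deriv (h : IsSmoothClosedCurve γ) : Function.Periodic (deriv γ) 1 := fun t => by
  rw [← deriv_comp_add_const, funext h.periodic]

theorem exists_int_of_eq (h : IsSmoothClosedCurve γ) {s t : ℝ} (hst : γ s = γ t) :
    ∃ n : ℤ, s = t + n := by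
  have hf : ∀ x, γ (Int.fract x) = γ x := fun x => by
    have := h.periodic.sub_int_mul_eq (x := x) ⌊x⌋
    rwa [mul_one] at this
  have := h.simple ⟨Int.fract_nonneg s, Int.fract_lt_one s⟩
    ⟨Int.fract_nonneg t, Int.fract_lt_one t⟩ (by rw [hf, hf, hst])
  refine ⟨⌊s⌋ - ⌊t⌋, ?_⟩
  rw [Int.fract, Int.fract] at this
  push_cast
  linarith

theorem continuous_normalOffset (h : IsSmoothClosedCurve γ) : Continuous (normalOffset γ) := by
  have h1 := h.continuous
  have h2 := h.continuous_deriv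
  unfold normalOffset
  fun_prop

theorem normalOffset_zero (t : ℝ) : normalOffset γ (t, 0) = γ t := by simp [normalOffset]

theorem normalOffset_add_int (h : IsSmoothClosedCurve γ) (t δ : ℝ) (n : ℤ) :
    normalOffset γ (t + n, δ) = normalOffset γ (t, δ) := by
  have h1 := h.periodic.int_mul n t
  have h2 := h.periodic_deriv.int_mul n t
  rw [mul_one] at h1 h2
  simp only [normalOffset, h1, h2]

/-- Near the curve, the normal coordinates are local coordinates of the plane. -/
theorem exists_openPartialHomeomorph (h : IsSmoothClosedCurve γ) (t : ℝ) :
    ∃ e : OpenPartialHomeomorph (ℝ × ℝ) ℂ, ⇑e = normalOffset γ ∧ (t, 0) ∈ e.source := by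
  set a := deriv γ t with ha
  have ha0 : a ≠ 0 := h.regular t
  -- The differential at `(t, 0)` has columns `γ'` and `i γ'`, so it is multiplication by `a ≠ 0`
  -- and the inverse function theorem applies.
  let L : ℝ × ℝ →L[ℝ] ℂ := (ContinuousLinearMap.fst ℝ ℝ ℝ).smulRight a +
    (ContinuousLinearMap.snd ℝ ℝ ℝ).smulRight (Complex.I * a)
  let M : ℂ →L[ℝ] ℝ × ℝ := (Complex.reCLM.prod Complex.imCLM).comp
    (ContinuousLinearMap.mul ℝ ℂ a⁻¹)
  let e : (ℝ × ℝ) ≃L[ℝ] ℂ := .equivOfInverse L M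
    (fun x => by
      have : a⁻¹ * (x.1 * a + x.2 * (Complex.I * a)) = x.1 + x.2 * Complex.I := by
        field_simp
      ext <;> simp [L, M, this])
    (fun z => by
      have : ((a⁻¹ * z).re : ℂ) * a + (a⁻¹ * z).im * (Complex.I * a) = z := by
        rw [← mul_assoc, ← add_mul, Complex.re_add_im, mul_comm a⁻¹, mul_assoc,
          inv_mul_cancel₀ ha0, mul_one]
      simpa [L, M] using this)
  have hs : HasStrictFDerivAt (normalOffset γ) (e : ℝ × ℝ →L[ℝ] ℂ) (t, 0) := by
    have hc : ContDiff ℝ ∞ (normalOffset γ) := by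
      have h1 := h.smooth
      have h2 := h.contDiff_deriv
      have h3 : ContDiff ℝ ∞ fun x : ℝ => (x : ℂ) := Complex.ofRealCLM.contDiff
      unfold normalOffset
      exact (h1.comp contDiff_fst).add ((h3.comp contDiff_snd).mul
        (contDiff_const.mul (h2.comp contDiff_fst)))
    have h4 := hc.contDiffAt.hasStrictFDerivAt (x := (t, 0)) (by simp)
    have h5 : fderiv ℝ (normalOffset γ) (t, 0) = e := by
      have hd := h4.hasFDerivAt
      have k1 : HasDerivAt (fun s => normalOffset γ (s, 0))
          (fderiv ℝ (normalOffset γ) (t, 0) (1, 0)) t :=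
        HasFDerivAt.comp_hasDerivAt (f := fun s : ℝ => (s, (0 : ℝ))) t hd
            ((hasDerivAt_id t).prodMk (hasDerivAt_const t (0 : ℝ)))
      have k2 : HasDerivAt (fun δ => normalOffset γ (t, δ))
          (fderiv ℝ (normalOffset γ) (t, 0) (0, 1)) 0 :=
        HasFDerivAt.comp_hasDerivAt (f := fun δ : ℝ => (t, δ)) 0 hd
            ((hasDerivAt_const 0 t).prodMk (hasDerivAt_id (0 : ℝ)))
      have k1' := k1.unique (by simpa only [normalOffset_zero] using h.hasDerivAt t)
      have k2' := k2.unique (f₁' := Complex.I * a) (by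
        simpa [normalOffset] using
          ((Complex.ofRealCLM.hasDerivAt (x := 0)).mul_const (Complex.I * a)).const_add (γ t))
      refine ContinuousLinearMap.ext fun x => ?_
      have hx : x = x.1 • ((1, 0) : ℝ × ℝ) + x.2 • ((0, 1) : ℝ × ℝ) := by ext <;> simp
      conv_lhs => rw [hx, map_add, map_smul, map_smul, k1', k2']
      simp [e, L, ha]
    rwa [h5] at h4
  exact ⟨hs.toOpenPartialHomeomorph _, rfl, hs.mem_toOpenPartialHomeomorph_source⟩

/-- Small normal offsets of the curve avoid the curve. -/
theorem exists_normalOffset_notMem (h : IsSmoothClosedCurve γ) :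
    ∃ δ₀ > 0, ∀ t δ, δ ≠ 0 → |δ| < δ₀ → normalOffset γ (t, δ) ∉ range γ := by
  have key : ∀ᶠ δ : ℝ in 𝓝 0, ∀ x ∈ Icc (0 : ℝ) 1 ×ˢ Icc (0 : ℝ) 1,
      normalOffset γ (x.1, δ) = γ x.2 → δ = 0 := by
    refine (isCompact_Icc.prod isCompact_Icc).eventually_forall_of_forall_eventually ?_
    rintro ⟨t, s⟩ -
    -- Parameters of the same point differ by a period, and injectivity of the normal chart forces
    -- `δ = 0`; distinct points stay apart by continuity.
    by_cases hst : γ s = γ t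
    · obtain ⟨n, rfl⟩ := h.exists_int_of_eq hst
      obtain ⟨e, he, hes⟩ := h.exists_openPartialHomeomorph t
      have h1 : ∀ᶠ z : ℝ × ℝ × ℝ in 𝓝 (0, t, t + n), (z.2.1, z.1) ∈ e.source :=
        (by fun_prop : Continuous fun z : ℝ × ℝ × ℝ => (z.2.1, z.1)).continuousAt.eventually
          (e.open_source.mem_nhds hes)
      have h2 : ∀ᶠ z : ℝ × ℝ × ℝ in 𝓝 (0, t, t + n), (z.2.2 - n, (0 : ℝ)) ∈ e.source :=
        (by fun_prop : Continuous fun z : ℝ × ℝ × ℝ => (z.2.2 - (n : ℝ), (0 : ℝ))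
          ).continuousAt.eventually
          (e.open_source.mem_nhds (by simpa using hes))
      filter_upwards [h1, h2] with z h1 h2 hz
      have h3 : normalOffset γ (z.2.2 - n, 0) = γ z.2.2 := by
        rw [← h.normalOffset_add_int _ _ n, sub_add_cancel, normalOffset_zero]
      have := e.injOn h1 h2 (by rw [he, hz, h3])
      exact congrArg Prod.snd this
    · have h1 : Continuous fun z : ℝ × ℝ × ℝ => normalOffset γ (z.2.1, z.1) :=
        h.continuous_normalOffset.comp (by fun_prop)
      have h2 : Continuous fun z : ℝ × ℝ × ℝ => γ z.2.2 := h.continuous.comp (by fun_prop)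
      have h3 := (h1.sub h2).continuousAt.eventually_ne (x := (0, t, s)) (y := 0)
        (by simpa [normalOffset_zero, sub_eq_zero] using Ne.symm hst)
      filter_upwards [h3] with z hz hz'
      exact absurd (sub_eq_zero.2 hz') hz
  obtain ⟨δ₀, hδ₀, hball⟩ := Metric.eventually_nhds_iff.1 key
  refine ⟨δ₀, hδ₀, fun t δ hδ hlt => ?_⟩
  rintro ⟨s, hs⟩
  refine hδ (hball (by simpa using hlt) (Int.fract t, Int.fract s)
    ⟨⟨Int.fract_nonneg t, (Int.fract_lt_one t).le⟩,
      ⟨Int.fract_nonneg s, (Int.fract_lt_one s).le⟩⟩ ?_)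
  have h1 := h.normalOffset_add_int (Int.fract t) δ ⌊t⌋
  have h2 := h.normalOffset_add_int (Int.fract s) 0 ⌊s⌋
  rw [Int.fract_add_floor] at h1 h2
  rw [normalOffset_zero, normalOffset_zero] at h2
  rw [← h1, ← h2, hs]

/-- A point off the curve lies on a normal to the curve, at a nearest point of the curve. -/
theorem exists_eq_normalOffset (h : IsSmoothClosedCurve γ) {p : ℂ} (hp : p ∉ range γ) :
    ∃ t c, c ≠ 0 ∧ p = normalOffset γ (t, c) ∧
      ∀ θ ∈ Ioc (0 : ℝ) 1, normalOffset γ (t, θ * c) ∉ range γ := by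
  have hcomp : IsCompact (range γ) := by
    have : γ '' Icc 0 1 = range γ := by simpa using h.periodic.image_Icc one_pos 0
    exact this ▸ isCompact_Icc.image h.continuous
  obtain ⟨q, ⟨t, rfl⟩, hmin⟩ := hcomp.exists_isMinOn (range_nonempty γ)
    (f := fun z => ‖z - p‖) (by fun_prop)
  have hmin' : ∀ s, ‖γ t - p‖ ≤ ‖γ s - p‖ := fun s => hmin (mem_range_self s)
  have hder := ((h.hasDerivAt t).sub_const p).norm_sq
  -- At a nearest point `p - γ t` is orthogonal to `γ'`, hence a real multiple of `i γ'`.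
  have h0 : IsLocalMin (fun s => ‖γ s - p‖ ^ 2) t :=
    Eventually.of_forall fun s => pow_le_pow_left₀ (norm_nonneg _) (hmin' s) 2
  have hperp := h0.hasDerivAt_eq_zero hder
  set a := deriv γ t with ha
  have ha0 : a ≠ 0 := h.regular t
  have hre : ((p - γ t) / a).re = 0 := by
    have : (p - γ t).re * a.re + (p - γ t).im * a.im = 0 := by
      rw [Complex.inner] at hperp
      simp at hperp ⊢
      linarith
    rw [Complex.div_re, ← add_div, this, zero_div]
  have hpe : p - γ t = ((p - γ t) / a).im * (Complex.I * a) := by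
    have : (p - γ t) / a = ((p - γ t) / a).im * Complex.I := by
      apply Complex.ext <;> simp [hre]
    rw [← mul_assoc, ← this, div_mul_cancel₀ _ ha0]
  set c := ((p - γ t) / a).im with hc
  have hoff : ∀ θ : ℝ, normalOffset γ (t, θ * c) = γ t + θ * (p - γ t) := fun θ => by
    rw [hpe, normalOffset]; push_cast; ring
  refine ⟨t, c, ?_, ?_, ?_⟩
  · intro h0
    rw [h0] at hpe
    simp only [Complex.ofReal_zero, zero_mul, sub_eq_zero] at hpe
    exact hp ⟨t, hpe.symm⟩
  · have := hoff 1
    simp only [one_mul, Complex.ofReal_one] at this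
    rw [this]; ring
  · rintro θ hθ ⟨s, hs⟩
    have h1 := hmin' s
    rw [hs, hoff] at h1
    -- Points of the segment beyond `γ t` are strictly closer to `p` than the nearest point of the
    -- curve.
    have h2 : γ t + θ * (p - γ t) - p = ((1 - θ : ℝ) : ℂ) * (γ t - p) := by push_cast; ring
    rw [h2, norm_mul, Complex.norm_real, Real.norm_of_nonneg (by linarith [hθ.2])] at h1
    have h3 : 0 < ‖γ t - p‖ := norm_pos_iff.2 (sub_ne_zero.2 fun h => hp ⟨t, h⟩)
    nlinarith [hθ.1]

end IsSmoothClosedCurve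

theorem subset_interior_or_subset_compl {X : Type*} [TopologicalSpace X] {D A : Set X}
    (hA : IsPreconnected A) (hAD : Disjoint A (frontier D)) :
    A ⊆ interior D ∨ A ⊆ (closure D)ᶜ := by
  refine hA.subset_or_subset isOpen_interior isClosed_closure.isOpen_compl ?_ fun z hz => ?_
  · exact disjoint_compl_right.mono_left (interior_subset.trans subset_closure)
  · by_contra hcon
    rw [mem_union, not_or, mem_compl_iff, not_not] at hcon
    exact hAD.notMem_of_mem_left hz ⟨hcon.2, hcon.1⟩

/-- The boundary curve has a collar: one side consists of interior points of the domain and the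
other one of exterior points. -/
theorem exists_collar {D : Set ℂ} (hD : IsCompact D) (hint : (interior D).Nonempty) {γ : ℝ → ℂ}
    (h : IsSmoothClosedCurve γ) (hr : range γ = frontier D) :
    ∃ σ : ℝ, (σ = 1 ∨ σ = -1) ∧ ∃ δ₀ > 0,
      (∀ t, ∀ δ ∈ Ioo 0 δ₀, normalOffset γ (t, σ * δ) ∈ interior D) ∧
      (∀ t, ∀ δ ∈ Ioo 0 δ₀, normalOffset γ (t, -(σ * δ)) ∉ D) := by
  obtain ⟨δ₀, hδ₀, hav⟩ := h.exists_normalOffset_notMem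
  have hcl : closure D = D := hD.isClosed.closure_eq
  -- Each open strip beside the curve is connected and misses the frontier, so it lies entirely
  -- inside or entirely outside.
  have hside : ∀ σ : ℝ, (σ = 1 ∨ σ = -1) →
      (∀ t, ∀ δ ∈ Ioo 0 δ₀, normalOffset γ (t, σ * δ) ∈ interior D) ∨
      (∀ t, ∀ δ ∈ Ioo 0 δ₀, normalOffset γ (t, σ * δ) ∉ D) := fun σ hσ => by
    have hpre : IsPreconnected ((fun x : ℝ × ℝ => normalOffset γ (x.1, σ * x.2)) ''
        (univ ×ˢ Ioo 0 δ₀)) :=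
      (isPreconnected_univ.prod isPreconnected_Ioo).image _
        (h.continuous_normalOffset.comp (by fun_prop)).continuousOn
    refine (subset_interior_or_subset_compl (D := D) hpre ?_).imp
      (fun hs t δ hδ => hs ⟨(t, δ), ⟨mem_univ _, hδ⟩, rfl⟩)
      (fun hs t δ hδ => hcl ▸ hs ⟨(t, δ), ⟨mem_univ _, hδ⟩, rfl⟩)
    rw [← hr, disjoint_left]
    rintro _ ⟨⟨t, δ⟩, ⟨-, hδ⟩, rfl⟩
    refine hav t _ ?_ ?_ <;> rcases hσ with rfl | rfl <;>
      simp [hδ.1.ne', abs_of_pos hδ.1, hδ.2]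
  -- The normal segment towards a nearest boundary point joins `p` to one of the two strips. As
  -- interior and exterior are both nonempty, each of them claims one strip.
  have hnear : ∀ p ∉ frontier D, ∃ σ : ℝ, (σ = 1 ∨ σ = -1) ∧ ∃ t, ∃ δ ∈ Ioo 0 δ₀,
      (p ∈ interior D ↔ normalOffset γ (t, σ * δ) ∈ interior D) := fun p hp => by
    obtain ⟨t, c, hc, hpc, hseg⟩ := h.exists_eq_normalOffset (hr ▸ hp)
    obtain ⟨σ, hσ, hσc⟩ : ∃ σ : ℝ, (σ = 1 ∨ σ = -1) ∧ c = σ * |c| := by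
      rcases lt_or_gt_of_ne hc with hc | hc
      · exact ⟨-1, .inr rfl, by rw [abs_of_neg hc]; ring⟩
      · exact ⟨1, .inl rfl, by rw [abs_of_pos hc]; ring⟩
    have hcp : 0 < |c| := abs_pos.2 hc
    -- This keeps the point on the segment and brings it within offset `δ₀ / 2` of the curve.
    set θ := min 1 (δ₀ / (2 * |c|)) with hθ
    have hθ0 : 0 < θ := lt_min one_pos (by positivity)
    have hθ1 : θ ≤ 1 := min_le_left _ _
    have hθc : θ * |c| < δ₀ := by
      calc θ * |c| ≤ δ₀ / (2 * |c|) * |c| := by gcongr; exact min_le_right _ _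
        _ = δ₀ / 2 := by field_simp
        _ < δ₀ := by linarith
    refine ⟨σ, hσ, t, θ * |c|, ⟨by positivity, hθc⟩, ?_⟩
    rw [show σ * (θ * |c|) = θ * c by rw [mul_left_comm, ← hσc]]
    have hpre : IsPreconnected ((fun θ : ℝ => normalOffset γ (t, θ * c)) '' Ioc 0 1) :=
      isPreconnected_Ioc.image _ (h.continuous_normalOffset.comp (by fun_prop)).continuousOn
    have hp1 : p ∈ (fun θ : ℝ => normalOffset γ (t, θ * c)) '' Ioc 0 1 :=
      ⟨1, ⟨one_pos, le_rfl⟩, by simp [hpc]⟩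
    have hp2 : normalOffset γ (t, θ * c) ∈ (fun θ : ℝ => normalOffset γ (t, θ * c)) '' Ioc 0 1 :=
      ⟨θ, ⟨hθ0, hθ1⟩, rfl⟩
    rcases subset_interior_or_subset_compl (D := D) hpre (by
      rw [← hr, disjoint_left]; rintro _ ⟨θ, hθ, rfl⟩; exact hseg θ hθ) with hs | hs
    · exact iff_of_true (hs hp1) (hs hp2)
    · exact iff_of_false (fun hi => hs hp1 (subset_closure (interior_subset hi)))
        fun hi => hs hp2 (subset_closure (interior_subset hi))
  obtain ⟨p, hp⟩ := hint
  obtain ⟨σ, hσ, t, δ, hδ, hiff⟩ := hnear p fun hf => hf.2 hp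
  have hin := (hside σ hσ).resolve_right fun hn => hn t δ hδ (interior_subset (hiff.1 hp))
  obtain ⟨q, hq⟩ : ∃ q, q ∉ D := by
    by_contra! hall
    exact noncompact_univ ℂ (eq_univ_of_forall hall ▸ hD)
  obtain ⟨τ, hτ, s, ε, hε, hiff'⟩ := hnear q fun hf => hq (hcl ▸ hf.1)
  have hout := (hside τ hτ).resolve_left fun hn => hq (interior_subset (hiff'.2 (hn s ε hε)))
  have hτσ : τ = -σ := by
    rcases hσ with rfl | rfl <;> rcases hτ with rfl | rfl
    · exact absurd (interior_subset (hin s ε hε)) (hout s ε hε)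
    · rfl
    · simp
    · exact absurd (interior_subset (hin s ε hε)) (hout s ε hε)
  refine ⟨σ, hσ, δ₀, hδ₀, hin, fun t δ hδ => ?_⟩
  rw [← neg_mul, ← hτσ]
  exact hout t δ hδ

/-- The curve `γ` bounds `D`, whose interior lies on the side `σ` of `γ`, up to distance `δ₀`. -/
structure IsCollar (D : Set ℂ) (γ : ℝ → ℂ) (σ δ₀ : ℝ) : Prop where
  curve : IsSmoothClosedCurve γ
  range_eq : range γ = frontier D
  sign : σ = 1 ∨ σ = -1
  pos : 0 < δ₀
  inner : ∀ t, ∀ δ ∈ Ioo 0 δ₀, normalOffset γ (t, σ * δ) ∈ interior D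
  outer : ∀ t, ∀ δ ∈ Ioo 0 δ₀, normalOffset γ (t, -(σ * δ)) ∉ D

/-! ### Consequences of the collar: local topology of the domain, logarithms, rotation of the
tangent -/

namespace IsCollar

variable {D : Set ℂ} {γ : ℝ → ℂ} {σ δ₀ : ℝ}

theorem sign_mul_self (h : IsCollar D γ σ δ₀) : σ * σ = 1 := by
  rcases h.sign with rfl | rfl <;> norm_num

theorem sign_ne_zero (h : IsCollar D γ σ δ₀) : σ ≠ 0 := by
  rcases h.sign with rfl | rfl <;> norm_num

theorem abs_sign (h : IsCollar D γ σ δ₀) : |σ| = 1 := by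
  rcases h.sign with rfl | rfl <;> norm_num

theorem curve_mem_frontier (h : IsCollar D γ σ δ₀) (t : ℝ) : γ t ∈ frontier D :=
  h.range_eq ▸ mem_range_self t

theorem curve_mem (h : IsCollar D γ σ δ₀) (hD : IsClosed D) (t : ℝ) : γ t ∈ D :=
  hD.frontier_subset (h.curve_mem_frontier t)

theorem curve_notMem_interior (h : IsCollar D γ σ δ₀) (t : ℝ) : γ t ∉ interior D :=
  (h.curve_mem_frontier t).2

theorem exists_pathConnected_nhds (h : IsCollar D γ σ δ₀) (hD : IsClosed D) {x : ℂ} (hx : x ∈ D)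
    {U : Set ℂ} (hU : U ∈ 𝓝 x) : ∃ W ∈ 𝓝[D] x, IsPathConnected W ∧ W ⊆ U ∩ D := by
  by_cases hxi : x ∈ interior D
  · obtain ⟨r, hr, hball⟩ := Metric.mem_nhds_iff.1 (inter_mem hU (mem_interior_iff_mem_nhds.1 hxi))
    exact ⟨Metric.ball x r, mem_nhdsWithin_of_mem_nhds (Metric.ball_mem_nhds x hr),
      (convex_ball x r).isPathConnected (Metric.nonempty_ball.2 hr), hball⟩
  · obtain ⟨t, rfl⟩ : x ∈ range γ := h.range_eq ▸ hD.frontier_eq ▸ ⟨hx, hxi⟩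
    obtain ⟨e, he, hes⟩ := h.curve.exists_openPartialHomeomorph t
    have hmap := e.map_nhds_eq hes
    rw [he, IsSmoothClosedCurve.normalOffset_zero] at hmap
    have hpre : normalOffset γ ⁻¹' U ∈ 𝓝 (t, (0 : ℝ)) := by
      rw [← hmap] at hU; exact hU
    obtain ⟨r, hr, hball⟩ := Metric.mem_nhds_iff.1 hpre
    set ρ := min r δ₀ with hρ
    have hρ0 : 0 < ρ := lt_min hr h.pos
    -- In normal coordinates `D` is locally a half-plane, so a convex half-box gives the
    -- neighbourhood.
    set B : Set (ℝ × ℝ) := Metric.ball t ρ ×ˢ (Metric.ball 0 ρ ∩ {δ | 0 ≤ σ * δ}) with hB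
    have hBc : Convex ℝ B := (convex_ball _ _).prod ((convex_ball _ _).inter
      ((convex_Ici (𝕜 := ℝ) (0 : ℝ)).is_linear_preimage (IsLinearMap.isLinearMap_smul σ)))
    have hBne : B.Nonempty := ⟨(t, 0), by simp [hB, hρ0]⟩
    refine ⟨normalOffset γ '' B, ?_,
      (hBc.isPathConnected hBne).image h.curve.continuous_normalOffset, ?_⟩
    · have h1 : normalOffset γ '' (Metric.ball (t, 0) ρ) ∈ 𝓝 (γ t) := by
        rw [← hmap]; exact image_mem_map (Metric.ball_mem_nhds _ hρ0)
      filter_upwards [mem_nhdsWithin_of_mem_nhds h1, self_mem_nhdsWithin] with z hz hzD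
      obtain ⟨⟨s, δ⟩, hs, rfl⟩ := hz
      rw [← ball_prod_same] at hs
      refine ⟨(s, δ), ⟨hs.1, hs.2, ?_⟩, rfl⟩
      by_contra hneg
      rw [mem_ofPred_eq, not_le] at hneg
      refine h.outer s (-(σ * δ)) ⟨by linarith, ?_⟩ ?_
      · have h2 : |δ| < ρ := by simpa using hs.2
        have h3 : |σ * δ| = |δ| := by rw [abs_mul, h.abs_sign, one_mul]
        have := neg_abs_le (σ * δ)
        have := min_le_right r δ₀
        linarith
      · convert hzD using 3
        linear_combination δ * h.sign_mul_self
    · rintro _ ⟨⟨s, δ⟩, ⟨hs, hδ, hσδ⟩, rfl⟩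
      refine ⟨hball ?_, ?_⟩
      · rw [← ball_prod_same]
        exact ⟨Metric.ball_subset_ball (min_le_left _ _) hs,
          Metric.ball_subset_ball (min_le_left _ _) hδ⟩
      · rw [mem_ofPred_eq] at hσδ
        rcases hσδ.eq_or_lt with h0 | h0
        · have : δ = 0 := (mul_eq_zero.1 h0.symm).resolve_left h.sign_ne_zero
          rw [this, IsSmoothClosedCurve.normalOffset_zero]
          exact h.curve_mem hD s
        · have := h.inner s (σ * δ) ⟨h0, by
            have h2 : |δ| < ρ := by simpa using hδ
            have h3 : |σ * δ| = |δ| := by rw [abs_mul, h.abs_sign, one_mul]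
            have := le_abs_self (σ * δ)
            have := min_le_right r δ₀
            linarith⟩
          rw [← mul_assoc, h.sign_mul_self, one_mul] at this
          exact interior_subset this

theorem locallyPathConnectedSpace (h : IsCollar D γ σ δ₀) (hD : IsClosed D) :
    LocallyPathConnectedSpace D where
  path_connected_basis x := by
    refine hasBasis_self.2 fun V hV => ?_
    obtain ⟨U, hU, hUV⟩ := mem_nhds_subtype _ _ _ |>.1 hV
    obtain ⟨W, hW, hWc, hWU⟩ := h.exists_pathConnected_nhds hD x.2 hU
    refine ⟨Subtype.val ⁻¹' W, preimage_coe_mem_nhds_subtype.2 hW, ?_,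
      (preimage_mono (hWU.trans inter_subset_left)).trans hUV⟩
    rwa [IsInducing.subtypeVal.isPathConnected_iff, Subtype.image_preimage_coe,
      inter_eq_right.2 (hWU.trans inter_subset_right)]

theorem exists_log (h : IsCollar D γ σ δ₀) (hD : IsClosed D) (hs : SimplyConnectedSpace D)
    (f : ℂ → ℂ) (hf : ContinuousOn f D) (h0 : ∀ z ∈ D, f z ≠ 0) :
    ∃ l : ℂ → ℂ, ContinuousOn l D ∧ ∀ z ∈ D, Complex.exp (l z) = f z := by
  have := h.locallyPathConnectedSpace hD
  obtain ⟨l, hl, hlf⟩ := exists_continuous_log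
    (hf.comp_continuous continuous_subtype_val Subtype.prop) fun z : D => h0 z z.2
  have hext : ∀ z : D, Function.extend Subtype.val l 0 (z : ℂ) = l z :=
    Subtype.val_injective.extend_apply l 0
  refine ⟨Function.extend Subtype.val l 0, ?_, fun z hz => ?_⟩
  · rw [continuousOn_iff_continuous_domRestrict]
    convert hl
    ext z
    exact hext z
  · rw [hext ⟨z, hz⟩]
    exact hlf ⟨z, hz⟩

/-- At a boundary point the tangent and the inner normal both lie in the tangent cone and span the
plane. This makes the one-sided derivative continuous up to the boundary. -/
theorem uniqueDiffOn (h : IsCollar D γ σ δ₀) (hD : IsClosed D) : UniqueDiffOn ℝ D := by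
  intro x hx
  by_cases hxi : x ∈ interior D
  · exact uniqueDiffWithinAt_of_mem_nhds (mem_interior_iff_mem_nhds.1 hxi)
  obtain ⟨t, rfl⟩ : x ∈ range γ := h.range_eq ▸ hD.frontier_eq ▸ ⟨hx, hxi⟩
  refine ⟨?_, subset_closure hx⟩
  set a := deriv γ t with ha
  have ha0 : a ≠ 0 := h.curve.regular t
  have h1 : a ∈ tangentConeAt ℝ D (γ t) := by
    refine mem_tangentConeAt_of_seq (𝓝[≠] (0 : ℝ)) (fun s => s⁻¹) (fun s => γ (t + s) - γ t) ?_ ?_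
      (hasDerivAt_iff_tendsto_slope_zero.1 (h.curve.hasDerivAt t))
    · have : Continuous fun s => γ (t + s) - γ t :=
        (h.curve.continuous.comp (by fun_prop)).sub continuous_const
      exact tendsto_nhdsWithin_of_tendsto_nhds (by simpa using this.tendsto 0)
    · exact Eventually.of_forall fun s => by
        rw [add_sub_cancel]; exact h.curve_mem hD _
  have h2 : σ * (Complex.I * a) ∈ tangentConeAt ℝ D (γ t) := by
    refine mem_tangentConeAt_of_add_smul_mem (l := 𝓝[>] (0 : ℝ)) (c := id)
      (tendsto_id.mono_left (nhdsWithin_mono _ fun s hs => (mem_Ioi.1 hs).ne')) ?_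
    filter_upwards [Ioo_mem_nhdsGT h.pos] with δ hδ
    convert interior_subset (h.inner t δ hδ) using 1
    simp [normalOffset, ha]
    ring
  have htop : Submodule.span ℝ (tangentConeAt ℝ D (γ t)) = ⊤ := by
    rw [eq_top_iff]
    intro z _
    have hz : z = (z / a).re • a + (σ * (z / a).im) • (σ * (Complex.I * a)) := by
      have hσ : (σ : ℂ) * σ = 1 := by exact_mod_cast h.sign_mul_self
      have h3 := Complex.re_add_im (z / a)
      have h4 := div_mul_cancel₀ z ha0
      simp only [Complex.real_smul, Complex.ofReal_mul]
      linear_combination (-1 : ℂ) * h4 - a * h3 - (z / a).im * Complex.I * a * hσ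
    rw [hz]
    exact Submodule.add_mem _ (Submodule.smul_mem _ _ (Submodule.subset_span h1))
      (Submodule.smul_mem _ _ (Submodule.subset_span h2))
  rw [htop]
  exact dense_univ

/-- An inner parallel curve does not wind around the points of the boundary curve. -/
theorem hasWinding_sub_normalOffset (h : IsCollar D γ σ δ₀) (hD : IsClosed D)
    (hs : SimplyConnectedSpace D) {δ : ℝ} (hδ : δ ∈ Ioo 0 δ₀) :
    HasWinding (fun t => γ 0 - normalOffset γ (t, σ * δ)) 0 := by
  have : PreconnectedSpace (Ico 0 δ₀) := Subtype.preconnectedSpace isPreconnected_Ico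
  have hper : ∀ t c, normalOffset γ (t + 1, c) = normalOffset γ (t, c) := fun t c => by
    simpa using h.curve.normalOffset_add_int t c 1
  have hN := h.curve.continuous_normalOffset
  have h0 : ∀ η ∈ Ico 0 δ₀, ∀ t,
      normalOffset γ (0, -(σ * η)) - normalOffset γ (t, σ * δ) ≠ 0 := fun η hη t => by
    refine sub_ne_zero.2 fun heq => ?_
    have hi := h.inner t δ hδ
    rcases hη.1.eq_or_lt with rfl | hpos
    · rw [← heq, mul_zero, neg_zero, IsSmoothClosedCurve.normalOffset_zero] at hi
      exact h.curve_notMem_interior 0 hi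
    · exact h.outer 0 η ⟨hpos, hη.2⟩ (heq ▸ interior_subset hi)
  have hδ' : δ ∈ Ico 0 δ₀ := ⟨hδ.1.le, hδ.2⟩
  -- Seen from a point `q` outside `D`, `q - z` has a logarithm on `D`, so no loop in `D` winds
  -- around `q`. Letting the outer offset `η` shrink to 0 moves `q` to `γ 0` without meeting the
  -- inner curve.
  have hw : HasWinding (fun t => normalOffset γ (0, -(σ * δ)) - normalOffset γ (t, σ * δ)) 0 := by
    obtain ⟨l, hl, hlq⟩ := h.exists_log hD hs (fun z => normalOffset γ (0, -(σ * δ)) - z)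
      (by fun_prop) fun z hz => sub_ne_zero.2 fun heq => h.outer 0 δ hδ (heq ▸ hz)
    have hmem : ∀ t, normalOffset γ (t, σ * δ) ∈ D := fun t => interior_subset (h.inner t δ hδ)
    have := HasWinding.of_log (l := fun t => l (normalOffset γ (t, σ * δ)))
      (hl.comp_continuous (hN.comp (by fun_prop)) hmem) fun t => by simp only [hper]
    simpa only [hlq _ (hmem _)] using this
  have := HasWinding.of_homotopy
    (H := fun (η : Ico 0 δ₀) t => normalOffset γ (0, -(σ * η)) - normalOffset γ (t, σ * δ))
    ((hN.comp (by fun_prop)).sub (hN.comp (by fun_prop))) (fun η t => by simp only [hper])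
    (fun η t => h0 η η.2 t) (x := ⟨δ, hδ'⟩) (y := ⟨0, le_rfl, h.pos⟩) hw
  simpa [IsSmoothClosedCurve.normalOffset_zero] using this

/-- The boundary curve winds around each interior point as often as its tangent rotates. -/
theorem hasWinding_sub (h : IsCollar D γ σ δ₀) (hD : IsClosed D)
    (hs : SimplyConnectedSpace D) {w : ℤ} (hw : HasWinding (deriv γ) w) {p : ℂ}
    (hp : p ∈ interior D) : HasWinding (fun t => γ t - p) w := by
  have hper : ∀ t c, normalOffset γ (t + 1, c) = normalOffset γ (t, c) := fun t c => by
    simpa using h.curve.normalOffset_add_int t c 1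
  have hN := h.curve.continuous_normalOffset
  have hγ := h.curve.continuous
  have hcol : ∀ t, ∀ δ ∈ Ioo 0 δ₀, HasWinding (fun s => γ s - normalOffset γ (t, σ * δ)) w := by
    intro t δ hδ
    have hne : ∀ s t, γ s - normalOffset γ (t, σ * δ) ≠ 0 := fun s t => sub_ne_zero.2 fun heq =>
      h.curve_notMem_interior s (heq ▸ h.inner t δ hδ)
    obtain ⟨w₁, hw₁⟩ := exists_hasWinding (c := fun s => γ s - normalOffset γ (0, σ * δ))
      (by fun_prop) (fun s => by simp only [h.curve.periodic s]) (fun s => hne s 0)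
    -- Hopf's torus argument: one factor gives the winding of `γ` around an inner point, the other
    -- gives 0, and the diagonal is a constant multiple of `γ'`.
    have hdiag := HasWinding.diagonal (H := fun s t => γ s - normalOffset γ (t, σ * δ))
      ((hγ.comp continuous_fst).sub (hN.comp (by fun_prop))) hne hw₁
      (h.hasWinding_sub_normalOffset hD hs hδ) (fun s t => by simp only [h.curve.periodic s])
      (fun s t => by simp only [hper])
    have hconst : (-(σ * δ * Complex.I) : ℂ) ≠ 0 := by
      simp [h.sign_ne_zero, hδ.1.ne', Complex.I_ne_zero]
    have hdiag' : HasWinding (fun t => γ t - normalOffset γ (t, σ * δ)) w := by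
      have := (HasWinding.const hconst).mul hw
      rw [zero_add] at this
      convert this using 2 with t
      simp only [normalOffset, Complex.ofReal_mul]
      ring
    have heq := hdiag.unique hdiag'
    rw [add_zero] at heq
    rw [heq] at hw₁
    exact HasWinding.of_homotopy (H := fun t s => γ s - normalOffset γ (t, σ * δ))
      ((hγ.comp continuous_snd).sub (hN.comp (by fun_prop)))
      (fun t s => by simp only [h.curve.periodic s]) (fun t s => hne s t) (x := 0) (y := t) hw₁
  obtain ⟨t, c, hc, hpc, hseg⟩ := h.curve.exists_eq_normalOffset
    (h.range_eq ▸ fun hf => hf.2 hp : p ∉ range γ)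
  have hcp : 0 < |c| := abs_pos.2 hc
  set θ := min 1 (δ₀ / (2 * |c|)) with hθ
  have hpos := h.pos
  have hθ0 : 0 < θ := lt_min one_pos (by positivity)
  have hθ1 : θ ≤ 1 := min_le_left _ _
  have hθc : θ * |c| < δ₀ := by
    calc θ * |c| ≤ δ₀ / (2 * |c|) * |c| := by gcongr; exact min_le_right _ _
      _ = δ₀ / 2 := by field_simp
      _ < δ₀ := by linarith
  have hδ : θ * |c| ∈ Ioo 0 δ₀ := ⟨by positivity, hθc⟩
  have hσc : c = σ * |c| ∨ c = -(σ * |c|) := by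
    rcases h.sign with rfl | rfl <;> rcases abs_choice c with h1 | h1 <;> rw [h1] <;> simp
  -- The segment from the interior point `p` misses the frontier, so it approaches the curve from
  -- the inner side.
  have hσc : c = σ * |c| := by
    refine hσc.resolve_right fun hneg => ?_
    have hpre : IsPreconnected ((fun θ : ℝ => normalOffset γ (t, θ * c)) '' Ioc 0 1) :=
      isPreconnected_Ioc.image _ (hN.comp (by fun_prop)).continuousOn
    have hp1 : p ∈ (fun θ : ℝ => normalOffset γ (t, θ * c)) '' Ioc 0 1 :=
      ⟨1, ⟨one_pos, le_rfl⟩, by simp [hpc]⟩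
    rcases subset_interior_or_subset_compl (D := D) hpre (by
      rw [← h.range_eq, disjoint_left]; rintro _ ⟨θ, hθ, rfl⟩; exact hseg θ hθ) with hsub | hsub
    · refine h.outer t _ hδ ?_
      rw [show -(σ * (θ * |c|)) = θ * c by rw [mul_left_comm, ← mul_neg, ← hneg]]
      exact interior_subset (hsub ⟨θ, ⟨hθ0, hθ1⟩, rfl⟩)
    · exact hsub hp1 (subset_closure (interior_subset hp))
  have hstart := hcol t _ hδ
  rw [show σ * (θ * |c|) = θ * c by rw [mul_left_comm, ← hσc]] at hstart
  have : PreconnectedSpace (Ioc (0 : ℝ) 1) := Subtype.preconnectedSpace isPreconnected_Ioc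
  have := HasWinding.of_homotopy
    (H := fun (θ : Ioc (0 : ℝ) 1) s => γ s - normalOffset γ (t, θ * c))
    ((hγ.comp continuous_snd).sub (hN.comp (by fun_prop)))
    (fun θ s => by simp only [h.curve.periodic s])
    (fun θ s => sub_ne_zero.2 fun heq => hseg θ θ.2 ⟨s, heq⟩)
    (x := ⟨θ, hθ0, hθ1⟩) (y := ⟨1, one_pos, le_rfl⟩) hstart
  simpa [← hpc] using this

end IsCollar

theorem IsSmoothDomain.exists_isCollar {D : Set ℂ} (hD : IsSmoothDomain D) :
    ∃ γ σ δ₀, IsCollar D γ σ δ₀ := by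
  obtain ⟨γ, hγ, hr⟩ := hD.boundary
  obtain ⟨σ, hσ, δ₀, hδ₀, hin, hout⟩ := exists_collar hD.isCompact hD.interior_nonempty hγ hr
  exact ⟨γ, σ, δ₀, hγ, hr, hσ, hδ₀, hin, hout⟩

/-! ### The conformal field -/

theorem conformalField_eq (D : Set ℂ) (F : ℂ → ℂ) (z : ℂ) :
    conformalField D F z = derivOn D F z 1 + Complex.I * derivOn D F z Complex.I := by
  apply Complex.ext <;> simp [conformalField]
  · ring
  · ring

/-- A similarity is complex linear or conjugate linear, and determinant 1 excludes the latter; `V =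
0` is the Cauchy–Riemann equation. -/
theorem IsSymplectomorphism.isConformalPoint_iff {D : Set ℂ} {F : ℂ → ℂ}
    (hF : IsSymplectomorphism D F) {z : ℂ} (hz : z ∈ D) :
    IsConformalPoint D F z ↔ conformalField D F z = 0 := by
  have hdet := hF.preserves_area z hz 1 Complex.I
  rw [conformalField_eq, IsConformalPoint, isConformalMap_iff_is_complex_or_conj_linear]
  generalize derivOn D F z = A at *
  simp only [area, Complex.one_re, Complex.one_im, Complex.I_re, Complex.I_im] at hdet
  constructor
  · rintro ⟨⟨B, hB⟩ | ⟨B, hB⟩, -⟩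
    · have h1 : A 1 = B 1 := by rw [← hB]; rfl
      have hI : A Complex.I = B Complex.I := by rw [← hB]; rfl
      have hBI : B Complex.I = Complex.I * B 1 := by
        rw [← smul_eq_mul, ← map_smul, smul_eq_mul, mul_one]
      rw [h1, hI, hBI, ← mul_assoc, Complex.I_mul_I]
      ring
    · exfalso
      have h1 : A 1 = B 1 := by
        simpa using (congrArg (fun L : ℂ →L[ℝ] ℂ => L 1) hB).symm
      have hI : A Complex.I = -B Complex.I := by
        have := (congrArg (fun L : ℂ →L[ℝ] ℂ => L Complex.I) hB).symm
        simp at this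
        rw [← this, neg_neg]
      have hBI : B Complex.I = Complex.I * B 1 := by
        rw [← smul_eq_mul, ← map_smul, smul_eq_mul, mul_one]
      rw [h1, hI, hBI] at hdet
      simp at hdet
      nlinarith [mul_self_nonneg (B 1).re, mul_self_nonneg (B 1).im]
  · intro h
    have hI : A Complex.I = Complex.I * A 1 := by
      linear_combination (-Complex.I) * h + A Complex.I * Complex.I_mul_I
    refine ⟨.inl ⟨ContinuousLinearMap.toSpanSingleton ℂ (A 1), ?_⟩, ?_⟩
    · ext v
      have hv : v = v.re • (1 : ℂ) + v.im • Complex.I := by simp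
      conv_rhs => rw [hv, map_add, map_smul, map_smul, hI]
      have := Complex.re_add_im v
      simp only [Complex.real_smul, ContinuousLinearMap.coe_restrictScalars',
        ContinuousLinearMap.toSpanSingleton_apply, smul_eq_mul]
      linear_combination (-A 1) * this
    · rintro rfl
      simp at hdet

/-- A linear area-preserving map that fixes `τ` is a shear along `τ`. -/
theorem shear_field {A : ℂ →L[ℝ] ℂ} (hA : ∀ u v, area (A u) (A v) = area u v) {τ : ℂ}
    (hτ : τ ≠ 0) (hfix : A τ = τ) :
    ∃ ρ : ℝ, A 1 + Complex.I * A Complex.I = ρ * (Complex.I * τ ^ 2) := by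
  obtain ⟨b, hb⟩ : ∃ b, b = A (Complex.I * τ) := ⟨_, rfl⟩
  have hdet := hA τ (Complex.I * τ)
  rw [hfix, ← hb] at hdet
  -- Preservation of the area of `(τ, iτ)` says that `A (iτ) - iτ` is a real multiple `μ` of `τ`.
  have hdiv : ((b - Complex.I * τ) / τ).im = 0 := by
    simp [area] at hdet
    rw [Complex.div_im, ← sub_div]
    simp
    left
    linear_combination hdet
  set μ := ((b - Complex.I * τ) / τ).re with hμ
  have hbμ : b = Complex.I * τ + μ * τ := by
    have h1 : (b - Complex.I * τ) / τ = μ := by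
      apply Complex.ext <;> simp [hμ, hdiv]
    rw [← h1, div_mul_cancel₀ _ hτ]
    ring
  set x := τ⁻¹.re with hx
  set y := τ⁻¹.im with hy
  have hxy : (x + y * Complex.I) * τ = 1 := by
    rw [hx, hy, Complex.re_add_im, inv_mul_cancel₀ hτ]
  have h1 : A 1 = x * τ + y * b := by
    have : (1 : ℂ) = x • τ + y • (Complex.I * τ) := by
      simp only [Complex.real_smul]; rw [← hxy]; ring
    conv_lhs => rw [this, map_add, map_smul, map_smul, hfix, ← hb]
    simp
  have hI : A Complex.I = x * b - y * τ := by
    have : Complex.I = x • (Complex.I * τ) - y • τ := by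
      simp only [Complex.real_smul]
      linear_combination (-Complex.I) * hxy + y * τ * Complex.I_mul_I
    conv_lhs => rw [this, map_sub, map_smul, map_smul, hfix, ← hb]
    simp
  have hconj : (x - y * Complex.I : ℂ) = τ * ((x ^ 2 + y ^ 2 : ℝ) : ℂ) := by
    push_cast
    linear_combination (-(x - y * Complex.I) : ℂ) * hxy - y ^ 2 * τ * Complex.I_mul_I
  -- As `x + iy = τ⁻¹`, the factor is `μ / |τ|²`.
  refine ⟨μ * (x ^ 2 + y ^ 2), ?_⟩
  rw [h1, hI, hbμ, Complex.ofReal_mul]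
  linear_combination μ * τ * Complex.I * hconj + (x * τ + μ * y * τ) * Complex.I_mul_I

theorem IsCollar.hasWinding_conformalField {D : Set ℂ} {γ : ℝ → ℂ} {σ δ₀ : ℝ}
    (h : IsCollar D γ σ δ₀) (hD : IsClosed D) {F : ℂ → ℂ} (hF : IsSymplectomorphism D F)
    (hid : ∀ z ∈ frontier D, F z = z) (hV : ContinuousOn (conformalField D F) D)
    (h0 : ∀ z ∈ frontier D, conformalField D F z ≠ 0) {w : ℤ} (hw : HasWinding (deriv γ) w) :
    HasWinding (fun t => conformalField D F (γ t)) (2 * w) := by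
  have hfix : ∀ t, derivOn D F (γ t) (deriv γ t) = deriv γ t := fun t => by
    have h1 : HasFDerivWithinAt F (derivOn D F (γ t)) D (γ t) :=
      (hF.smooth.differentiableOn (by simp) _ (h.curve_mem hD t)).hasFDerivWithinAt
    have h2 := h1.comp_hasDerivAt t (h.curve.hasDerivAt t)
      (Eventually.of_forall fun s => h.curve_mem hD s)
    have h3 : F ∘ γ = γ := funext fun s => hid _ (h.curve_mem_frontier s)
    rw [h3] at h2
    exact h2.unique (h.curve.hasDerivAt t)
  choose ρ hρ using fun t => shear_field (hF.preserves_area _ (h.curve_mem hD t))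
    (h.curve.regular t) (hfix t)
  simp only [← conformalField_eq] at hρ
  have hsq : ∀ t, Complex.I * deriv γ t ^ 2 ≠ 0 := fun t =>
    mul_ne_zero Complex.I_ne_zero (pow_ne_zero 2 (h.curve.regular t))
  have hVγ : Continuous fun t => conformalField D F (γ t) :=
    hV.comp_continuous h.curve.continuous (h.curve_mem hD)
  have hρe : ∀ t, (ρ t : ℂ) = conformalField D F (γ t) / (Complex.I * deriv γ t ^ 2) := fun t => by
    rw [hρ, mul_div_cancel_right₀ _ (hsq t)]
  have hρC : Continuous fun t => (ρ t : ℂ) := by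
    simp only [hρe]
    exact hVγ.div (continuous_const.mul (h.curve.continuous_deriv.pow 2)) hsq
  have hρc : Continuous ρ := Complex.continuous_re.comp hρC
  have hρ0 : ∀ t, ρ t ≠ 0 := fun t h1 => h0 _ (h.curve_mem_frontier t) (by rw [hρ, h1]; simp)
  have hρp : Function.Periodic (fun t => (ρ t : ℂ)) 1 := fun t => by
    simp only [hρe, h.curve.periodic t, h.curve.periodic_deriv t]
  obtain ⟨n, hn⟩ := exists_hasWinding hρC hρp fun t => Complex.ofReal_ne_zero.2 (hρ0 t)
  -- The square of `ρ` is positive and has a real periodic logarithm, so `2n = 0`.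
  have hn0 : n = 0 := by
    have h1 := HasWinding.of_log (l := fun t => ((Real.log (ρ t ^ 2) : ℝ) : ℂ))
      (Complex.continuous_ofReal.comp ((hρc.pow 2).log fun t => pow_ne_zero 2 (hρ0 t)))
      fun t => by simp only [Complex.ofReal_injective (hρp t)]
    have h2 : HasWinding (fun t => (ρ t : ℂ) * ρ t) 0 := by
      convert h1 using 2 with t
      rw [← Complex.ofReal_exp, Real.exp_log (by have := hρ0 t; positivity)]
      push_cast; ring
    have := (hn.mul hn).unique h2
    omega
  have := hn.mul ((HasWinding.const Complex.I_ne_zero).mul (hw.zpow 2))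
  rw [hn0, zero_add, zero_add] at this
  convert this using 2 with t
  rw [hρ]
  norm_cast

end ConformalPoints

/-! ### Comparison of the two boundary winding numbers -/

open ConformalPoints

theorem mainTheorem4 (D : Set ℂ) (hD : ConformalPoints.IsSmoothDomain D) (F : ℂ → ℂ)
    (hF : ConformalPoints.IsSymplectomorphism D F)
    (hmod : ConformalPoints.IsModerate D F)
    (hid : ∀ z ∈ frontier D, F z = z)
    (hbd : ∀ z ∈ frontier D, ¬ ConformalPoints.IsConformalPoint D F z) :
    {z ∈ interior D | ConformalPoints.IsConformalPoint D F z}.Infinite ∨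
      ∃ (s : Finset ℂ) (m : ℂ → ℤ),
        (s : Set ℂ) = {z ∈ interior D | ConformalPoints.IsConformalPoint D F z} ∧
        (∀ z ∈ s, ConformalPoints.HasMultiplicity D F z (m z)) ∧
        2 ≤ ∑ z ∈ s, m z := by
  rw [or_iff_not_imp_left, not_infinite]
  intro hfin
  obtain ⟨γ, σ, δ₀, h⟩ := hD.exists_isCollar
  have hcl : IsClosed D := hD.isCompact.isClosed
  have hV : ContinuousOn (conformalField D F) D := by
    have h1 : ContinuousOn (derivOn D F) D :=
      hF.smooth.continuousOn_fderivWithin (h.uniqueDiffOn hcl) (by simp)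
    rw [funext (conformalField_eq D F)]
    fun_prop
  obtain ⟨w, hw⟩ := exists_hasWinding h.curve.continuous_deriv h.curve.periodic_deriv
    h.curve.regular
  have hwp : ∀ p ∈ interior D, HasWinding (fun t => γ t - p) w := fun p hp =>
    h.hasWinding_sub hcl hD.simplyConnected hw hp
  have hw0 : w ≠ 0 := by
    rintro rfl
    obtain ⟨p, hp⟩ := hD.interior_nonempty
    exact not_hasWinding_frontier hD.isCompact h.curve.continuous h.curve.periodic h.curve.simple
      h.range_eq hp (hwp p hp)
  set s := hfin.toFinset with hs
  have hsD : (s : Set ℂ) ⊆ interior D := fun z hz => by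
    rw [hs, hfin.coe_toFinset] at hz
    exact hz.1
  have h0 : ∀ z ∈ D \ s, conformalField D F z ≠ 0 := fun z hz => by
    rw [Ne, ← hF.isConformalPoint_iff hz.1]
    intro hc
    by_cases hzi : z ∈ interior D
    · exact hz.2 (by rw [hs, hfin.coe_toFinset]; exact ⟨hzi, hc⟩)
    · exact hbd z ⟨subset_closure hz.1, hzi⟩ hc
  have hloc : ∀ p ∈ s, ∃ n, HasLocalWinding (conformalField D F) p n := fun p hp => by
    -- The disc is chosen in the interior and free of the other zeros.
    obtain ⟨R, hR, hball⟩ := Metric.isOpen_iff.1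
      (isOpen_interior.sdiff (s.finite_toSet.subset (sdiff_subset (t := {p}))).isClosed) p
      ⟨hsD hp, fun hp' => hp'.2 rfl⟩
    refine exists_hasLocalWinding hR
      (hV.mono fun z hz => interior_subset (hball hz.1).1) fun z hz => ?_
    exact h0 z ⟨interior_subset (hball hz.1).1, fun hzs => (hball hz.1).2 ⟨hzs, hz.2⟩⟩
  choose! m hm using hloc
  refine ⟨s, m, hfin.coe_toFinset, fun z hz => (hm z hz).hasIndex, ?_⟩
  have h1 := HasWinding.of_localWinding (h.exists_log hcl hD.simplyConnected) h.curve.continuous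
    h.curve.periodic (h.curve_mem hcl) h.curve_notMem_interior hwp m s _ hsD
    (hV.mono sdiff_subset) h0 hm
  have h2 := h.hasWinding_conformalField hcl hF hid hV
    (fun z hz => (hF.isConformalPoint_iff (hcl.frontier_subset hz)).not.1 (hbd z hz)) hw
  -- Both counts agree, so the index sum times `w` equals `2w` with `w ≠ 0`.
  exact (mul_right_cancel₀ hw0 (h1.unique h2)).ge
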